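/- Let $M$ be a compact (Hausdorff, boundaryless) $C^\infty$ manifold of dimension $n$, let $\mathfrak X(M)$ be the space of its $C^\infty$ vector fields, and let $\mathrm{Diff}(M)$ be the group of its $C^\infty$ diffeomorphisms under composition, equipped with the $C^\infty$ topology (uniform convergence of all derivatives in local charts). Let $\mathcal G$ be an arbitrary subgroup of $\mathrm{Diff}(M)$. A vector field $X\in\mathfrak X(M)$ is called tangent to $\mathcal G$ if there are an open interval $I\ni 0$, a $C^\infty$ curve $t\mapsto\varphi_t$, $I\to\mathrm{Diff}(M)$ (that is, $(t,p)\mapsto\varphi_t(p)$ is $C^\infty$ on $I\times M$), and an integer $k\ge 1$ such that $\varphi_t\in\mathcal G$ for all $t\in I$, $\varphi_0=\mathrm{id}_M$, and for every $p\in M$ $$\frac{\partial^{j}\varphi_t(p)}{\partial t^{j}}\Big|_{t=0}=0\quad(1\le j<k),\qquad \frac{\partial^{k}\varphi_t(p)}{\partial t^{k}}\Big|_{t=0}=X(p).$$ Let $\mathcal T_o\mathcal G\subset\mathfrak X(M)$ be the set of vector fields tangent to $\mathcal G$. Let $\exp\colon\mathfrak X(M)\to\mathrm{Diff}(M)$ be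 the map that takes $X$ to the time-one map of its flow. Theorem. The exponential map is well defined: for every $X\in\mathfrak X(M)$ the integral curves of $X$ exist for all times, and the time-one map of the flow of $X$ is a $C^\infty$ diffeomorphism of $M$. Moreover, the group generated by the exponential image of $\mathcal T_o\mathcal G$ is contained in the closure of $\mathcal G$ in the $C^\infty$ topology: $$\big\langle \exp(\mathcal T_o\mathcal G)\big\rangle\subset\overline{\mathcal G}.$$ -/

import Mathlib

open Set Topology
open scoped Manifold ContDiff

noncomputable section

namespace DiffTangent

/-- The `C^∞` vector fields on the manifold `M` (modelled on `ℝⁿ`): smooth sections of `TM`. -/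
abbrev VectorFields (n : ℕ) (M : Type*) [TopologicalSpace M]
    [ChartedSpace (EuclideanSpace ℝ (Fin n)) M] [IsManifold (𝓡 n) ∞ M] :=
  ContMDiffSection (𝓡 n) (EuclideanSpace ℝ (Fin n)) ∞ (TangentSpace (𝓡 n) : M → Type _)

/-- The `C^∞` diffeomorphisms of `M`. -/
abbrev Diff (n : ℕ) (M : Type*) [TopologicalSpace M]
    [ChartedSpace (EuclideanSpace ℝ (Fin n)) M] :=
  Diffeomorph (𝓡 n) (𝓡 n) M M ∞

section

variable {n : ℕ} {M : Type*} [TopologicalSpace M] [ChartedSpace (EuclideanSpace ℝ (Fin n)) M]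

/-- `Diff(M)` is a group under composition, `(f * g) p = f (g p)`. -/
instance instGroupDiff : Group (Diff n M) where
  mul f g := Diffeomorph.trans g f
  one := Diffeomorph.refl (𝓡 n) M ∞
  inv f := f.symm
  mul_assoc _ _ _ := rfl
  one_mul _ := rfl
  mul_one _ := rfl
  inv_mul_cancel f := Diffeomorph.ext f.symm_apply_apply

theorem mul_apply (f g : Diff n M) (p : M) : (f * g) p = f (g p) := rfl

theorem one_apply (p : M) : (1 : Diff n M) p = p := rfl

theorem inv_apply (f : Diff n M) (p : M) : f⁻¹ p = f.symm p := rfl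

/-- The representative `ψ ∘ f ∘ φ⁻¹` of `f` in the charts `φ` and `ψ`. It is a total function on
`ℝⁿ`, and is meaningful on the open set `φ (φ.source ∩ f⁻¹ (ψ.source))`. -/
def localRep (φ ψ : OpenPartialHomeomorph M (EuclideanSpace ℝ (Fin n))) (f : Diff n M) :
    EuclideanSpace ℝ (Fin n) → EuclideanSpace ℝ (Fin n) :=
  fun x => ψ (f (φ.symm x))

/-- The set of all `g` that map `K` into the domain of `ψ` and for which all partial derivatives of
order at most `r` of `ψ ∘ g ∘ φ⁻¹` are, on `φ (K)`, within `ε` of those of `ψ ∘ f ∘ φ⁻¹`. -/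
def subbasicSet (f : Diff n M) (φ ψ : OpenPartialHomeomorph M (EuclideanSpace ℝ (Fin n)))
    (K : Set M) (r : ℕ) (ε : ℝ) : Set (Diff n M) :=
  {g | MapsTo g K ψ.source ∧ ∀ j ≤ r, ∀ p ∈ K,
    ‖iteratedFDeriv ℝ j (localRep φ ψ g) (φ p) - iteratedFDeriv ℝ j (localRep φ ψ f) (φ p)‖ < ε}

variable (n M) in
/-- The `C^∞` topology on `Diff(M)`, `M` compact (uniform convergence of all derivatives). It is
generated by the sets `subbasicSet f φ ψ K r ε`, where `φ`, `ψ` are smooth charts of `M`,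
`K ⊆ φ.source` is compact, `f (K) ⊆ ψ.source`, `r : ℕ` and `ε > 0`. -/
@[reducible]
def smoothTopology : TopologicalSpace (Diff n M) :=
  TopologicalSpace.generateFrom
    {U | ∃ (f : Diff n M) (φ ψ : OpenPartialHomeomorph M (EuclideanSpace ℝ (Fin n)))
        (K : Set M) (r : ℕ) (ε : ℝ),
      φ ∈ IsManifold.maximalAtlas (𝓡 n) ∞ M ∧ ψ ∈ IsManifold.maximalAtlas (𝓡 n) ∞ M ∧
      IsCompact K ∧ K ⊆ φ.source ∧ MapsTo f K ψ.source ∧ 0 < ε ∧ U = subbasicSet f φ ψ K r ε}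

/-- A curve `t ↦ φ t` in `Diff(M)` is `C^∞` on the interval `I` if `(t, p) ↦ φ t p` is a `C^∞` map
on `I × M`. -/
def IsSmoothCurveOn (φ : ℝ → Diff n M) (I : Set ℝ) : Prop :=
  ContMDiffOn (𝓘(ℝ, ℝ).prod (𝓡 n)) (𝓡 n) ∞ (fun q : ℝ × M => φ q.1 q.2) (I ×ˢ univ)

/-- The curve `c` through `p = c 0` is a `k`-th order integral curve of the tangent vector
`v ∈ T_p M`: its derivatives at `0` of the orders `1, …, k - 1` vanish, and the `k`-th one is `v`.
Derivatives are taken in the preferred chart at `p`, in which Mathlib's `TangentSpace (𝓡 n) p` is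
identified with `ℝⁿ`. -/
def IsIntegralCurveOfOrder (k : ℕ) (c : ℝ → M) (p : M) (v : TangentSpace (𝓡 n) p) : Prop :=
  c 0 = p ∧
  (∀ j, 1 ≤ j → j < k → iteratedDeriv j (fun t => chartAt (EuclideanSpace ℝ (Fin n)) p (c t)) 0 = 0) ∧
  iteratedDeriv k (fun t => chartAt (EuclideanSpace ℝ (Fin n)) p (c t)) 0 = v

variable [IsManifold (𝓡 n) ∞ M]

/-- `T₀G`: the vector fields `X` tangent to the subgroup `G` of `Diff(M)`, i.e. those for which
there is a smooth curve `φ : I → Diff(M)` on an open interval `I ∋ 0`, with values in `G` and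
`φ 0 = id`, and a `k ≥ 1` such that every `t ↦ φ t p` is a `k`-th order integral curve of `X p`. -/
def tangentAlgebra (G : Subgroup (Diff n M)) : Set (VectorFields n M) :=
  {X | ∃ (I : Set ℝ) (φ : ℝ → Diff n M), IsOpen I ∧ I.OrdConnected ∧ 0 ∈ I ∧
    IsSmoothCurveOn φ I ∧ (∀ t ∈ I, φ t ∈ G) ∧ φ 0 = 1 ∧
    ∃ k : ℕ, 1 ≤ k ∧ ∀ p : M, IsIntegralCurveOfOrder k (fun t => φ t p) p (X p)}

/-- `f` is the time-one map of the flow of `X`: for every `p`, the integral curve `γ : ℝ → M` of `X`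
with `γ 0 = p` exists for all times, and `f p = γ 1`. -/
def IsTimeOneMap (X : VectorFields n M) (f : Diff n M) : Prop :=
  ∀ p : M, ∃ γ : ℝ → M, γ 0 = p ∧ IsMIntegralCurve γ (fun q => X q) ∧ f p = γ 1

open Classical in
/-- The exponential map `exp : 𝔛(M) → Diff(M)`, which takes `X` to the time-one map of its flow. -/
def exp (X : VectorFields n M) : Diff n M :=
  if h : ∃ f : Diff n M, IsTimeOneMap X f then h.choose else 1

end

end DiffTangent

end

/-! Let `φ` be a curve in `G` that is tangent to `X` to order `k`, and put `τ m = (k! / m) ^ (1 /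
k)`. By Taylor's formula `φ (τ m)` is the identity plus `X / m` plus `o(1 / m)`, so it is one step,
of size `1 / m`, of a consistent scheme for the equation of `X`. Its `m`-th power lies in `G` for
large `m` and converges to `exp X`. All of this has to hold with every derivative.

The analysis takes place in a vector space. A partition of unity embeds `M` in `(ℝⁿ × ℝ)^N`; vector
fields and displacements extend to compactly supported maps there, and the extended scheme restricts
to `φ (τ m)` on the image of `M`. Consistency in `C^r` follows from Hadamard's lemma: the
displacement is `t ^ k` times a smooth function of `(t, x)` (`SmoothConv.of_tendsto_pow_smul`).
Convergence in `C^0` is the usual Euler argument by a discrete Gronwall estimate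
(`tendsto_iterate_euler`). Convergence in `C^r` follows by induction on `r`
(`SmoothConv.iterate_euler`): the lift `(x, A) ↦ (f x, f'(x) ∘ A)` commutes with iteration, is
linear in `f`, and turns a scheme for `Y` into a scheme for the variational equation, so convergence
of derivatives is convergence of a lifted scheme. The explicit Euler scheme also gives smoothness of
the flow, hence existence of `exp`.

Limits of sequences in `G` form a subgroup because this convergence respects products and inverses
(`DiffConv.mul`, `DiffConv.inv`). That subgroup contains `exp (T₀G)` and lies in the topological
closure, so no group property of the closure itself is needed. -/

open Filter

/-! ### Continuous convergence of maps and their derivatives -/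

/-- `SmoothConv l r f g x`: the maps `f i` converge to `g` near `x` along `l`, together with their
derivatives up to order `r`, in the sense of continuous convergence at `x`. -/
def SmoothConv {ι : Type*} (l : Filter ι) {E : Type} [NormedAddCommGroup E] [NormedSpace ℝ E] :
    ∀ (_ : ℕ) {F : Type} [NormedAddCommGroup F] [NormedSpace ℝ F],
      (ι → E → F) → (E → F) → E → Prop
  | 0, _, _, _, f, g, x => Tendsto (fun q : ι × E => f q.1 q.2) (l ×ˢ 𝓝 x) (𝓝 (g x))
  | r + 1, _, _, _, f, g, x =>
    Tendsto (fun q : ι × E => f q.1 q.2) (l ×ˢ 𝓝 x) (𝓝 (g x)) ∧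
    (∀ᶠ q in l ×ˢ 𝓝 x, DifferentiableAt ℝ (f q.1) q.2) ∧
    (∀ᶠ y in 𝓝 x, DifferentiableAt ℝ g y) ∧
    SmoothConv l r (fun i => fderiv ℝ (f i)) (fderiv ℝ g) x

/-- Identities that hold eventually in `(i, y)` can be differentiated in `y` only if they hold in a
whole neighbourhood of `y` for fixed `i`; this supplies it. -/
theorem Filter.Eventually.eventually_nhds_prod {ι X : Type*} [TopologicalSpace X] {l : Filter ι}
    {x : X} {P : ι × X → Prop} (h : ∀ᶠ q in l ×ˢ 𝓝 x, P q) :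
    ∀ᶠ q in l ×ˢ 𝓝 x, ∀ᶠ y in 𝓝 q.2, P (q.1, y) := by
  obtain ⟨pa, ha, pb, hb, hab⟩ := Filter.eventually_prod_iff.1 h
  exact Filter.eventually_prod_iff.2
    ⟨pa, ha, _, hb.eventually_nhds, fun hi _ hy => hy.mono fun _ hz => hab hi hz⟩

namespace SmoothConv

variable {ι : Type*} {l : Filter ι} {E F G : Type}
  [NormedAddCommGroup E] [NormedSpace ℝ E] [NormedAddCommGroup F] [NormedSpace ℝ F]
  [NormedAddCommGroup G] [NormedSpace ℝ G] {r : ℕ}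

theorem tendsto {f : ι → E → F} {g : E → F} {x : E} (h : SmoothConv l r f g x) :
    Tendsto (fun q : ι × E => f q.1 q.2) (l ×ˢ 𝓝 x) (𝓝 (g x)) := by
  cases r with
  | zero => exact h
  | succ r => exact h.1

theorem of_succ {f : ι → E → F} {g : E → F} {x : E} (h : SmoothConv l (r + 1) f g x) :
    SmoothConv l r f g x := by
  induction r generalizing F with
  | zero => exact h.1
  | succ r ih => exact ⟨h.1, h.2.1, h.2.2.1, ih h.2.2.2⟩

theorem congr {f f' : ι → E → F} {g g' : E → F} {x : E} (h : SmoothConv l r f g x)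
    (hf : ∀ᶠ q in l ×ˢ 𝓝 x, f q.1 q.2 = f' q.1 q.2) (hg : g =ᶠ[𝓝 x] g') :
    SmoothConv l r f' g' x := by
  induction r generalizing F with
  | zero =>
    change Tendsto _ _ _
    rw [← hg.eq_of_nhds]
    exact Tendsto.congr' hf h
  | succ r ih =>
    have hf' := hf.eventually_nhds_prod
    refine ⟨?_, ?_, ?_, ih h.2.2.2 ?_ hg.fderiv⟩
    · rw [← hg.eq_of_nhds]
      exact Tendsto.congr' hf h.1
    · filter_upwards [h.2.1, hf'] with q hq hq'
      exact hq.congr_of_eventuallyEq (EventuallyEq.symm hq')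
    · filter_upwards [h.2.2.1, hg.eventually_nhds] with y hy hy'
      exact hy.congr_of_eventuallyEq (EventuallyEq.symm hy')
    · filter_upwards [hf'] with q hq
      exact EventuallyEq.fderiv_eq hq

theorem const {g : E → F} {x : E} (h : ContDiffAt ℝ r g x) :
    SmoothConv l r (fun _ => g) g x := by
  induction r generalizing F with
  | zero => exact h.continuousAt.tendsto.comp tendsto_snd
  | succ r ih =>
    have hd : ∀ᶠ y in 𝓝 x, DifferentiableAt ℝ g y :=
      (h.eventually (by simp)).mono fun y hy => hy.differentiableAt (by simp)
    exact ⟨h.continuousAt.tendsto.comp tendsto_snd, tendsto_snd.eventually hd, hd,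
      ih (h.fderiv_right (by simp))⟩

/-- The derivative of `L ∘ f` is again a fixed linear map applied to that of `f`, so the induction
closes without the general chain rule, whose proof rests on this case. -/
theorem clm_comp (L : F →L[ℝ] G) {f : ι → E → F} {g : E → F} {x : E} (h : SmoothConv l r f g x) :
    SmoothConv l r (fun i y => L (f i y)) (fun y => L (g y)) x := by
  induction r generalizing F G with
  | zero => exact (L.continuous.tendsto _).comp h
  | succ r ih =>
    refine ⟨(L.continuous.tendsto _).comp h.1, ?_, ?_, ?_⟩
    · filter_upwards [h.2.1] with q hq using L.differentiableAt.comp q.2 hq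
    · filter_upwards [h.2.2.1] with q hq using L.differentiableAt.comp q hq
    · refine (ih (ContinuousLinearMap.compL ℝ E F G L) h.2.2.2).congr ?_ ?_
      · filter_upwards [h.2.1] with q hq
        exact (L.hasFDerivAt.comp q.2 hq.hasFDerivAt).fderiv.symm
      · filter_upwards [h.2.2.1] with q hq
        exact (L.hasFDerivAt.comp q hq.hasFDerivAt).fderiv.symm

theorem prodMk {f : ι → E → F} {f' : ι → E → G} {g : E → F} {g' : E → G} {x : E}
    (h : SmoothConv l r f g x) (h' : SmoothConv l r f' g' x) :
    SmoothConv l r (fun i y => (f i y, f' i y)) (fun y => (g y, g' y)) x := by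
  induction r generalizing F G with
  | zero => exact Tendsto.prodMk_nhds h h'
  | succ r ih =>
    refine ⟨Tendsto.prodMk_nhds h.1 h'.1, ?_, ?_, ?_⟩
    · filter_upwards [h.2.1, h'.2.1] with q hq hq' using hq.prodMk hq'
    · filter_upwards [h.2.2.1, h'.2.2.1] with q hq hq' using hq.prodMk hq'
    · refine (clm_comp ((ContinuousLinearMap.prodₗᵢ ℝ :
        (E →L[ℝ] F) × (E →L[ℝ] G) ≃ₗᵢ[ℝ] _) : _ →L[ℝ] (E →L[ℝ] F × G))
        (ih h.2.2.2 h'.2.2.2)).congr ?_ ?_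
      · filter_upwards [h.2.1, h'.2.1] with q hq hq'
        exact (hq.hasFDerivAt.prodMk hq'.hasFDerivAt).fderiv.symm
      · filter_upwards [h.2.2.1, h'.2.2.1] with q hq hq'
        exact (hq.hasFDerivAt.prodMk hq'.hasFDerivAt).fderiv.symm

/-- Continuous convergence is stable under composition. -/
theorem comp {f : ι → F → G} {g : F → G} {f' : ι → E → F} {g' : E → F} {x : E}
    (h : SmoothConv l r f g (g' x)) (h' : SmoothConv l r f' g' x) :
    SmoothConv l r (fun i y => f i (f' i y)) (fun y => g (g' y)) x := by
  have key : ∀ {r : ℕ} {E F G : Type} [NormedAddCommGroup E] [NormedSpace ℝ E]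
      [NormedAddCommGroup F] [NormedSpace ℝ F] [NormedAddCommGroup G] [NormedSpace ℝ G]
      {f : ι → F → G} {g : F → G} {f' : ι → E → F} {g' : E → F} {x : E}
      (_ : SmoothConv l r f g (g' x)) (_ : SmoothConv l r f' g' x), 
      Tendsto (fun q : ι × E => (q.1, f' q.1 q.2)) (l ×ˢ 𝓝 x) (l ×ˢ 𝓝 (g' x)) :=
    fun _ h' => tendsto_fst.prodMk h'.tendsto
  induction r generalizing E F G with
  | zero => exact Tendsto.comp h (key h h')
  | succ r ih =>
    have hd := (key h h').eventually h.2.1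
    have hc : ContinuousAt g' x := h'.2.2.1.self_of_nhds.continuousAt
    have hd' := hc.eventually h.2.2.1
    refine ⟨h.tendsto.comp (key h h'), ?_, ?_, ?_⟩
    · filter_upwards [hd, h'.2.1] with q hq hq'
      exact hq.comp q.2 hq'
    · filter_upwards [hd', h'.2.2.1] with q hq hq'
      exact hq.comp q hq'
    · have h1 := ih h.2.2.2 h'.of_succ
      have h2 := h1.prodMk h'.2.2.2
      -- By the chain rule the derivative is the bilinear composition of two convergent factors;
      -- this is an instance of the same statement at order `r`, with the outer map constant in `i`.
      have h3 := ih (f := fun _ (p : (F →L[ℝ] G) × (E →L[ℝ] F)) => p.1.comp p.2)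
        (const (g := fun (p : (F →L[ℝ] G) × (E →L[ℝ] F)) => p.1.comp p.2)
        (isBoundedBilinearMap_comp.contDiff.contDiffAt)) h2
      refine h3.congr ?_ ?_
      · filter_upwards [hd, h'.2.1] with q hq hq'
        exact (fderiv_comp q.2 hq hq').symm
      · filter_upwards [hd', h'.2.2.1] with q hq hq'
        exact (fderiv_comp q hq hq').symm

/-- Post-composition with a fixed smooth map. -/
theorem comp_left {g : F → G} {f' : ι → E → F} {g' : E → F} {x : E}
    (hg : ContDiffAt ℝ r g (g' x)) (h' : SmoothConv l r f' g' x) :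
    SmoothConv l r (fun i y => g (f' i y)) (fun y => g (g' y)) x :=
  comp (const hg) h'

/-- Pre-composition with a fixed smooth map. -/
theorem comp_right {f : ι → F → G} {g : F → G} {g' : E → F} {x : E}
    (h : SmoothConv l r f g (g' x)) (hg : ContDiffAt ℝ r g' x) :
    SmoothConv l r (fun i y => f i (g' y)) (fun y => g (g' y)) x :=
  comp h (const hg)

theorem add {f f' : ι → E → F} {g g' : E → F} {x : E}
    (h : SmoothConv l r f g x) (h' : SmoothConv l r f' g' x) :
    SmoothConv l r (fun i y => f i y + f' i y) (fun y => g y + g' y) x :=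
  comp_left (g := fun p : F × F => p.1 + p.2) contDiff_add.contDiffAt (h.prodMk h')

theorem sum {κ : Type*} (s : Finset κ) {f : κ → ι → E → F} {g : κ → E → F} {x : E}
    (h : ∀ a ∈ s, SmoothConv l r (f a) (g a) x) :
    SmoothConv l r (fun i y => ∑ a ∈ s, f a i y) (fun y => ∑ a ∈ s, g a y) x := by
  classical
  induction s using Finset.induction_on with
  | empty => simpa using const (l := l) (contDiffAt_const (c := (0 : F)))
  | insert a s ha ih =>
    simp only [Finset.sum_insert ha]
    exact (h a (Finset.mem_insert_self a s)).add
      (ih fun b hb => h b (Finset.mem_insert_of_mem hb))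

theorem smul {f : ι → E → ℝ} {f' : ι → E → F} {g : E → ℝ} {g' : E → F} {x : E}
    (h : SmoothConv l r f g x) (h' : SmoothConv l r f' g' x) :
    SmoothConv l r (fun i y => f i y • f' i y) (fun y => g y • g' y) x :=
  comp_left (g := fun p : ℝ × F => p.1 • p.2) contDiff_smul.contDiffAt (h.prodMk h')

theorem tendsto_iteratedFDeriv {f : ι → E → F} {g : E → F} {x : E} (h : SmoothConv l r f g x)
    {j : ℕ} (hj : j ≤ r) :
    Tendsto (fun q : ι × E => iteratedFDeriv ℝ j (f q.1) q.2) (l ×ˢ 𝓝 x)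
      (𝓝 (iteratedFDeriv ℝ j g x)) := by
  induction j generalizing F r with
  | zero =>
    simp only [iteratedFDeriv_zero_eq_comp, Function.comp]
    exact ((continuousMultilinearCurryFin0 ℝ E F).symm.continuous.tendsto _).comp h.tendsto
  | succ j ih =>
    obtain ⟨r, rfl⟩ : ∃ s, r = s + 1 := ⟨r - 1, by omega⟩
    simp only [iteratedFDeriv_succ_eq_comp_right, Function.comp]
    exact ((continuousMultilinearCurryRightEquiv' ℝ j E F).symm.continuous.tendsto _).comp
      (ih h.2.2.2 (by omega))

/-- Order `r + 1` includes differentiability of the `r`-th derivative of `g`, hence its continuity.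
-/
theorem contDiff {f : ι → E → F} {g : E → F} (h : ∀ x, SmoothConv l (r + 1) f g x) :
    ContDiff ℝ r g := by
  induction r generalizing F with
  | zero =>
    exact contDiff_zero.2
      (continuous_iff_continuousAt.2 fun x => (h x).2.2.1.self_of_nhds.continuousAt)
  | succ r ih =>
    exact contDiff_succ_iff_fderiv.2
      ⟨fun x => (h x).2.2.1.self_of_nhds, by simp, ih fun x => (h x).2.2.2⟩

/-- Local inverses of converging maps converge. -/
theorem of_inverse [CompleteSpace F] {f : ι → F → E} {g : F → E} {f' : ι → E → F} {g' : E → F}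
    {x : E}
    (h : SmoothConv l r f g (g' x))
    (h' : Tendsto (fun q : ι × E => f' q.1 q.2) (l ×ˢ 𝓝 x) (𝓝 (g' x)))
    (hf : ∀ᶠ q in l ×ˢ 𝓝 x, DifferentiableAt ℝ (f' q.1) q.2)
    (hg : ∀ᶠ y in 𝓝 x, DifferentiableAt ℝ g' y)
    (hfl : ∀ᶠ q in l ×ˢ 𝓝 x, f q.1 (f' q.1 q.2) = q.2)
    (hfr : ∀ᶠ q in l ×ˢ 𝓝 (g' x), f' q.1 (f q.1 q.2) = q.2)
    (hgl : ∀ᶠ y in 𝓝 x, g (g' y) = y)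
    (hgr : ∀ᶠ y in 𝓝 (g' x), g' (g y) = y) :
    SmoothConv l r f' g' x := by
  induction r with
  | zero => exact h'
  | succ r ih =>
    have ih := ih h.of_succ
    have hc : ContinuousAt g' x := hg.self_of_nhds.continuousAt
    have key : Tendsto (fun q : ι × E => (q.1, f' q.1 q.2)) (l ×ˢ 𝓝 x) (l ×ˢ 𝓝 (g' x)) :=
      tendsto_fst.prodMk h'
    -- Differentiating both inverse relations shows that the two derivatives are inverse to each
    -- other.
    have aux : ∀ {a : F → E} {b : E → F} {y : E}, DifferentiableAt ℝ a (b y) →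
        DifferentiableAt ℝ b y → (∀ᶠ z in 𝓝 y, a (b z) = z) → (∀ᶠ z in 𝓝 (b y), b (a z) = z) →
        ∃ A : F ≃L[ℝ] E, (A : F →L[ℝ] E) = fderiv ℝ a (b y) ∧
          (fderiv ℝ a (b y)).inverse = fderiv ℝ b y := by
      intro a b y ha hb hab hba
      have e1 : (fderiv ℝ a (b y)).comp (fderiv ℝ b y) = ContinuousLinearMap.id ℝ E := by
        rw [← fderiv_comp y ha hb, ← fderiv_id (𝕜 := ℝ) (x := y)]
        exact EventuallyEq.fderiv_eq hab
      have e2 : (fderiv ℝ b y).comp (fderiv ℝ a (b y)) = ContinuousLinearMap.id ℝ F := by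
        have hy : a (b y) = y := hab.self_of_nhds
        have hb' : DifferentiableAt ℝ b (a (b y)) := by rwa [hy]
        have := fderiv_comp (b y) hb' ha
        rw [hy] at this
        rw [← this, ← fderiv_id (𝕜 := ℝ) (x := b y)]
        exact EventuallyEq.fderiv_eq hba
      let A : F ≃L[ℝ] E := ContinuousLinearEquiv.equivOfInverse (fderiv ℝ a (b y)) (fderiv ℝ b y)
        (fun z => DFunLike.congr_fun e2 z) (fun z => DFunLike.congr_fun e1 z)
      refine ⟨A, rfl, ?_⟩
      change (A : F →L[ℝ] E).inverse = _
      rw [ContinuousLinearMap.inverse_equiv]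
      rfl
    refine ⟨h', hf, hg, ?_⟩
    -- The derivative of `f'` is operator inversion applied to `Df ∘ f'`. Order `r` for `f'`,
    -- already known, therefore gives order `r` for its derivative.
    have h1 := comp h.2.2.2 ih
    have hinv : ContDiffAt ℝ r ContinuousLinearMap.inverse (fderiv ℝ g (g' x)) := by
      obtain ⟨A, hA, -⟩ := aux h.2.2.1.self_of_nhds hg.self_of_nhds hgl hgr
      rw [← hA]
      exact contDiffAt_map_inverse A
    refine (comp_left (g' := fun y => fderiv ℝ g (g' y)) hinv h1).congr ?_ ?_
    · filter_upwards [key.eventually h.2.1, hf, hfl.eventually_nhds_prod,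
        key.eventually hfr.eventually_nhds_prod] with q h1 h2 h3 h4
      exact (aux h1 h2 h3 h4).choose_spec.2
    · filter_upwards [hc.eventually h.2.2.1, hg, hgl.eventually_nhds,
        hc.eventually hgr.eventually_nhds] with q h1 h2 h3 h4
      exact (aux h1 h2 h3 h4).choose_spec.2

end SmoothConv

/-- Finitely many of the product neighbourhoods cover `K`; this turns continuous convergence at
points into uniform estimates. -/
theorem IsCompact.eventually_forall_of_prod {ι X : Type*} [TopologicalSpace X] {l : Filter ι}
    {K : Set X} (hK : IsCompact K) {P : ι → X → Prop}
    (h : ∀ x ∈ K, ∀ᶠ q in l ×ˢ 𝓝 x, P q.1 q.2) : ∀ᶠ i in l, ∀ x ∈ K, P i x := by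
  refine hK.induction_on (p := fun s => ∀ᶠ i in l, ∀ x ∈ s, P i x) (by simp)
    (fun s t hst ht => ht.mono fun i hi x hx => hi x (hst hx))
    (fun s t hs ht => by
      filter_upwards [hs, ht] with i h1 h2 x hx using hx.elim (h1 x) (h2 x)) ?_
  intro x hx
  obtain ⟨pa, ha, pb, hb, hab⟩ := Filter.eventually_prod_iff.1 (h x hx)
  exact ⟨{y | pb y}, mem_nhdsWithin_of_mem_nhds hb, ha.mono fun i hi y hy => hab hi hy⟩

/-! ### One-step schemes and differential equations on the unit interval -/

section Euler

variable {E : Type*} [NormedAddCommGroup E] [NormedSpace ℝ E]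

/-- Local truncation error of one Euler step along an integral curve. -/
theorem eventually_norm_euler_step_le {Y : E → E} (hY : Continuous Y) {z : ℝ → E}
    (hz : ∀ t ∈ Icc (0 : ℝ) 1, HasDerivWithinAt z (Y (z t)) (Icc 0 1) t) {ε : ℝ} (hε : 0 < ε) :
    ∃ δ > 0, ∀ h : ℝ, 0 ≤ h → h < δ → ∀ t, 0 ≤ t → t + h ≤ 1 →
      ‖z (t + h) - z t - h • Y (z t)‖ ≤ ε * h := by
  have hc : ContinuousOn (fun t => Y (z t)) (Icc (0 : ℝ) 1) :=
    hY.comp_continuousOn fun t ht => (hz t ht).continuousWithinAt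
  obtain ⟨δ, hδ, H⟩ := Metric.uniformContinuousOn_iff.1
    (isCompact_Icc.uniformContinuousOn_of_continuous hc) ε hε
  refine ⟨δ, hδ, fun h h0 hlt t t0 ht => ?_⟩
  have hsub : Icc t (t + h) ⊆ Icc (0 : ℝ) 1 := Icc_subset_Icc t0 ht
  -- The mean value inequality is applied to `s ↦ z s - s • Y (z t)`, whose derivative is small by
  -- uniform continuity of `Y ∘ z`.
  have hd : ∀ s ∈ Icc t (t + h), HasDerivWithinAt (fun s => z s - s • Y (z t))
      (Y (z s) - (1 : ℝ) • Y (z t)) (Icc t (t + h)) s := fun s hs =>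
    ((hz s (hsub hs)).mono hsub).sub ((hasDerivWithinAt_id s _).smul_const _)
  have hb : ∀ s ∈ Icc t (t + h), ‖Y (z s) - (1 : ℝ) • Y (z t)‖ ≤ ε := fun s hs => by
    rw [one_smul, ← dist_eq_norm]
    refine (H s (hsub hs) t (hsub ⟨le_rfl, by linarith⟩) ?_).le
    rw [Real.dist_eq, abs_of_nonneg (by linarith [hs.1])]
    linarith [hs.2]
  have := (convex_Icc t (t + h)).norm_image_sub_le_of_norm_hasDerivWithin_le hd hb
    (left_mem_Icc.2 (by linarith)) (right_mem_Icc.2 (by linarith))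
  rw [add_sub_cancel_left, Real.norm_of_nonneg h0] at this
  convert this using 2
  module

/-- Convergence of a consistent one-step scheme. -/
theorem tendsto_iterate_euler [FiniteDimensional ℝ E] {Y : E → E} (hY : ContDiff ℝ 1 Y) {z : ℝ → E}
    (hz : ∀ t ∈ Icc (0 : ℝ) 1, HasDerivWithinAt z (Y (z t)) (Icc 0 1) t) {F : ℕ → E → E}
    (hF : ∀ y, Tendsto (fun q : ℕ × E => (q.1 : ℝ) • (F q.1 q.2 - q.2)) (atTop ×ˢ 𝓝 y)
      (𝓝 (Y y))) :
    Tendsto (fun q : ℕ × E => (F q.1)^[q.1] q.2) (atTop ×ˢ 𝓝 (z 0)) (𝓝 (z 1)) := by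
  have hzc : ContinuousOn z (Icc 0 1) := fun t ht => (hz t ht).continuousWithinAt
  obtain ⟨R, hR⟩ := (isCompact_Icc.image_of_continuousOn hzc).isBounded.subset_closedBall 0
  have hzR : ∀ t ∈ Icc (0 : ℝ) 1, ‖z t‖ ≤ R := fun t ht => by
    simpa using hR (mem_image_of_mem z ht)
  -- The exact solution stays in the ball of radius `R`; the extra `1` leaves room for the numerical
  -- error.
  set K : Set E := Metric.closedBall 0 (R + 1)
  have hK : IsCompact K := isCompact_closedBall 0 (R + 1)
  obtain ⟨L, hL⟩ := (hY.locallyLipschitz.locallyLipschitzOn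
      (s := K)).exists_lipschitzOnWith_of_compact hK
  set B : ℝ := Real.exp L
  have hB : 0 < B := Real.exp_pos _
  rw [Metric.tendsto_nhds]
  intro η hη
  -- The `3 * ε` collects the initial error, the truncation errors and the consistency defects; `B`
  -- bounds their amplification. The bound `1` keeps the iterates in `K`.
  obtain ⟨ε, hε, hε1, hε2⟩ : ∃ ε > 0, B * (3 * ε) ≤ 1 ∧ B * (3 * ε) < η := by
    refine ⟨min 1 (η / 2) / (3 * B), by positivity, ?_, ?_⟩
    · have : B * (3 * (min 1 (η / 2) / (3 * B))) = min 1 (η / 2) := by field_simp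
      rw [this]; exact min_le_left _ _
    · have : B * (3 * (min 1 (η / 2) / (3 * B))) = min 1 (η / 2) := by field_simp
      rw [this]; exact lt_of_le_of_lt (min_le_right _ _) (by linarith)
  obtain ⟨δ, hδ, hstep⟩ := eventually_norm_euler_step_le hY.continuous hz hε
  have hcons : ∀ᶠ m : ℕ in atTop, ∀ y ∈ K, ‖(m : ℝ) • (F m y - y) - Y y‖ < ε := by
    refine hK.eventually_forall_of_prod (P := fun (m : ℕ) y => ‖(m : ℝ) • (F m y - y) - Y y‖ < ε)
      fun y _ => ?_
    have h2 : Tendsto (fun q : ℕ × E => Y q.2) (atTop ×ˢ 𝓝 y) (𝓝 (Y y)) :=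
      (hY.continuous.tendsto y).comp tendsto_snd
    have := ((hF y).sub h2).norm
    rw [sub_self, norm_zero] at this
    exact this.eventually (gt_mem_nhds hε)
  have hsmall : ∀ᶠ m : ℕ in atTop, 1 / (m : ℝ) < δ :=
    (tendsto_one_div_atTop_nhds_zero_nat (𝕜 := ℝ)).eventually (gt_mem_nhds hδ)
  have hx : ∀ᶠ x in 𝓝 (z 0), ‖x - z 0‖ < ε := by
    simp only [← dist_eq_norm]
    exact Metric.ball_mem_nhds (z 0) hε
  filter_upwards [((hcons.and hsmall).and (eventually_gt_atTop 0)).prod_mk hx]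
  rintro ⟨m, x⟩ ⟨⟨⟨hcons, hsmall⟩, hm⟩, hx⟩
  simp only at hcons hsmall hm hx ⊢
  have hm' : (0 : ℝ) < m := by exact_mod_cast hm
  set h : ℝ := 1 / m
  have hh : 0 < h := by positivity
  have hmh : (m : ℝ) * h = 1 := by simp only [h]; field_simp
  have hpow : ∀ j ≤ m, (1 + L * h) ^ j ≤ B := fun j hj => by
    calc (1 + L * h) ^ j ≤ (Real.exp (L * h)) ^ j := by
          gcongr
          rw [add_comm]; exact Real.add_one_le_exp _
      _ = Real.exp (j * (L * h)) := (Real.exp_nat_mul _ _).symm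
      _ ≤ B := by
          apply Real.exp_le_exp.2
          have : (j : ℝ) ≤ m := by exact_mod_cast hj
          calc (j : ℝ) * (L * h) = L * (j * h) := by ring
            _ ≤ L * (m * h) := by gcongr
            _ = L := by rw [hmh, mul_one]
  -- Discrete Gronwall estimate. The bound at `j` also places the `j`-th iterate in `K`, where the
  -- consistency and Lipschitz estimates for the next step hold.
  have main : ∀ j ≤ m, ‖(F m)^[j] x - z (j * h)‖ ≤ (1 + L * h) ^ j * (ε + 2 * ε * (j * h)) := by
    intro j
    induction j with
    | zero => intro _; simpa using hx.le
    | succ j ih =>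
      intro hj
      have ih := ih (by omega)
      have hjh : ((j : ℝ) + 1) * h ≤ 1 := by
        have : ((j : ℝ) + 1) * h ≤ m * h := by gcongr; exact_mod_cast hj
        linarith
      have hj0 : 0 ≤ (j : ℝ) * h := by positivity
      have hjmem : (j : ℝ) * h ∈ Icc (0 : ℝ) 1 := ⟨hj0, by linarith⟩
      set y := (F m)^[j] x
      set w := z (j * h)
      have hbd : (1 + L * h) ^ j * (ε + 2 * ε * (j * h)) ≤ 1 := by
        refine le_trans ?_ hε1
        gcongr
        · exact hpow j (by omega)
        · nlinarith [hjmem.2]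
      have hwK : w ∈ K := by
        simp only [K, mem_closedBall_zero_iff]; linarith [hzR _ hjmem]
      have hyK : y ∈ K := by
        simp only [K, mem_closedBall_zero_iff]
        have : y = w + (y - w) := by abel
        rw [this]
        exact (norm_add_le _ _).trans (add_le_add (hzR _ hjmem) (ih.trans hbd))
      have e1 : ‖F m y - y - h • Y y‖ ≤ ε * h := by
        have : F m y - y - h • Y y = h • ((m : ℝ) • (F m y - y) - Y y) := by
          rw [smul_sub, smul_smul, mul_comm h, hmh, one_smul]
        rw [this, norm_smul, Real.norm_of_nonneg hh.le, mul_comm]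
        gcongr
        exact (hcons y hyK).le
      have e2 := hstep h hh.le hsmall (j * h) hj0 (by linarith)
      have e3 : ‖Y y - Y w‖ ≤ L * ‖y - w‖ := by
        simpa [dist_eq_norm] using hL.dist_le_mul y hyK w hwK
      rw [Function.iterate_succ_apply', Nat.cast_succ, show ((j : ℝ) + 1) * h = j * h + h by ring]
      have : F m y - z (j * h + h) = (F m y - y - h • Y y) - (z (j * h + h) - w - h • Y w)
          + ((y - w) + h • (Y y - Y w)) := by module
      calc ‖F m y - z (j * h + h)‖ ≤ ε * h + ε * h + (‖y - w‖ + h * (L * ‖y - w‖)) := by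
            rw [this]
            refine (norm_add_le _ _).trans (add_le_add ((norm_sub_le _ _).trans
              (add_le_add e1 e2)) ((norm_add_le _ _).trans (add_le_add le_rfl ?_)))
            rw [norm_smul, Real.norm_of_nonneg hh.le]
            gcongr
        _ = 2 * ε * h + (1 + L * h) * ‖y - w‖ := by ring
        _ ≤ (1 + L * h) ^ (j + 1) * (2 * ε * h) +
            (1 + L * h) * ((1 + L * h) ^ j * (ε + 2 * ε * (j * h))) := by
            have : 1 ≤ (1 + L * h) ^ (j + 1) := one_le_pow₀ (by
              have : 0 ≤ L * h := by positivity
              linarith)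
            have h3 : 0 ≤ 2 * ε * h := by positivity
            refine add_le_add (by nlinarith) ?_
            gcongr
        _ = _ := by ring
  have := main m le_rfl
  rw [hmh] at this
  rw [dist_eq_norm]
  refine lt_of_le_of_lt this (lt_of_le_of_lt ?_ hε2)
  have e : ε + 2 * ε * 1 = 3 * ε := by ring
  rw [e]
  gcongr
  exact hpow m le_rfl

open scoped NNReal

/-- A bounded Lipschitz time-dependent vector field has integral curves on `[0, 1]`. -/
theorem exists_integralCurve_of_bounded [CompleteSpace E] {f : ℝ → E → E} {K L : ℝ≥0}
    (hK : ∀ t ∈ Icc (0 : ℝ) 1, LipschitzWith K (f t))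
    (hc : ∀ x, ContinuousOn (f · x) (Icc 0 1)) (hL : ∀ t ∈ Icc (0 : ℝ) 1, ∀ x, ‖f t x‖ ≤ L)
        (x : E) :
    ∃ z : ℝ → E, z 0 = x ∧ ∀ t ∈ Icc (0 : ℝ) 1, HasDerivWithinAt z (f t (z t)) (Icc 0 1) t := by
  -- At speed at most `L` the ball of radius `L` cannot be left in unit time.
  have h : IsPicardLindelof f (tmin := 0) (tmax := 1) ⟨0, by simp⟩ x L 0 L K :=
    { lipschitzOnWith := fun t ht => (hK t ht).lipschitzOnWith
      continuousOn := fun x _ => hc x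
      norm_le := fun t ht x _ => hL t ht x
      mul_max_le := by simp }
  exact h.exists_eq_forall_mem_Icc_hasDerivWithinAt₀

/-- Linear time-dependent differential equations are solvable on `[0, 1]`. -/
theorem exists_linear_ode [FiniteDimensional ℝ E] {B : ℝ → E →L[ℝ] E}
    (hB : ContinuousOn B (Icc 0 1)) (v : E) :
    ∃ z : ℝ → E, z 0 = v ∧ ∀ t ∈ Icc (0 : ℝ) 1, HasDerivWithinAt z (B t (z t)) (Icc 0 1) t := by
  obtain ⟨C, hC⟩ := isCompact_Icc.exists_bound_of_continuousOn hB
  have hC0 : 0 ≤ C := (norm_nonneg _).trans (hC 0 (by simp))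
  -- Gronwall bounds solutions by `‖v‖ * exp C`, so the cutoff that makes the equation bounded is
  -- never felt along the solution.
  let R : ℝ := ‖v‖ * Real.exp C + 1
  have hR : 0 < R := by positivity
  let β : ContDiffBump (0 : E) := ⟨R, R + 1, hR, by linarith⟩
  have hw : ContDiff ℝ 1 (fun x : E => β x • x) := β.contDiff.smul contDiff_id
  have hws : HasCompactSupport (fun x : E => β x • x) := β.hasCompactSupport.smul_right
  obtain ⟨K, hK⟩ := hw.lipschitzWith_of_hasCompactSupport hws one_ne_zero
  obtain ⟨D, hD⟩ := hws.exists_bound_of_continuous hw.continuous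
  have hD0 : 0 ≤ D := (norm_nonneg _).trans (hD 0)
  have hwle : ∀ x : E, ‖β x • x‖ ≤ ‖x‖ := fun x => by
    rw [norm_smul, Real.norm_of_nonneg β.nonneg]
    exact mul_le_of_le_one_left (norm_nonneg _) β.le_one
  have hBw : ∀ t ∈ Icc (0 : ℝ) 1, ∀ y : E, ‖B t y‖ ≤ C * ‖y‖ := fun t ht y =>
    ((B t).le_opNorm y).trans (by gcongr; exact hC t ht)
  obtain ⟨z, hz0, hz⟩ := exists_integralCurve_of_bounded (f := fun t x => B t (β x • x))
    (K := C.toNNReal * K) (L := (C * D).toNNReal)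
    (fun t ht => by
      have : LipschitzWith C.toNNReal (B t) := (B t).lipschitz.weaken (by
        rw [← NNReal.coe_le_coe, Real.coe_toNNReal _ hC0]; exact hC t ht)
      exact this.comp hK)
    (fun x => hB.clm_apply continuousOn_const)
    (fun t ht x => by
      rw [Real.coe_toNNReal _ (by positivity)]
      exact (hBw t ht _).trans (by gcongr; exact hD x)) v
  have hbound : ∀ t ∈ Icc (0 : ℝ) 1, ‖z t‖ ≤ R := fun t ht => by
    have := norm_le_gronwallBound_of_norm_deriv_right_le (f := z) (K := C) (ε := 0) (δ := ‖v‖)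
      (fun t ht => (hz t ht).continuousWithinAt)
      (fun t ht => (hz t (Ico_subset_Icc_self ht)).mono_of_mem_nhdsWithin
        (Icc_mem_nhdsGE_of_mem ht)) (by rw [hz0])
      (fun t ht => by
        rw [add_zero]
        exact (hBw t (Ico_subset_Icc_self ht) _).trans (by gcongr; exact hwle _)) t ht
    rw [gronwallBound_ε0] at this
    refine this.trans ?_
    have : Real.exp (C * (t - 0)) ≤ Real.exp C := Real.exp_le_exp.2 (by nlinarith [ht.2])
    have := mul_le_mul_of_nonneg_left this (norm_nonneg v)
    linarith
  refine ⟨z, hz0, fun t ht => ?_⟩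
  have h1 : β (z t) = 1 := β.one_of_mem_closedBall (by simpa [β] using hbound t ht)
  simpa [h1] using hz t ht

end Euler

/-! ### The lift to the frame bundle -/

section Lift

variable {E : Type*} [NormedAddCommGroup E] [NormedSpace ℝ E]

/-- `Φ` consists of integral curves of `Y` on `[0, 1]`. -/
def IsUnitFlow (Y : E → E) (Φ : ℝ → E → E) : Prop :=
  ∀ x, Φ 0 x = x ∧
    ∀ t ∈ Icc (0 : ℝ) 1, HasDerivWithinAt (fun s => Φ s x) (Y (Φ t x)) (Icc 0 1) t

/-- The lift `(x, A) ↦ (f x, f'(x) ∘ A)` of `f` to the frame bundle. -/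
noncomputable def frameLift (f : E → E) (q : E × (E →L[ℝ] E)) : E × (E →L[ℝ] E) :=
  (f q.1, (fderiv ℝ f q.1).comp q.2)

theorem ContDiff.frameLift {f : E → E} (hf : ContDiff ℝ ∞ f) :
    ContDiff ℝ ∞ (_root_.frameLift f) :=
  (hf.comp contDiff_fst).prodMk
    (((hf.fderiv_right (m := ∞) (by simp)).comp contDiff_fst).clm_comp contDiff_snd)

/-- This is the chain rule in functorial form. It lets derivatives of iterates be read off from
iterates of the lift. -/
theorem iterate_frameLift {f : E → E} (hf : Differentiable ℝ f) (m : ℕ) :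
    (frameLift f)^[m] = frameLift (f^[m]) := by
  induction m with
  | zero => ext1 q; simp [frameLift]
  | succ m ih =>
    ext1 q
    rw [Function.iterate_succ_apply', ih, Function.iterate_succ']
    simp only [frameLift, Function.comp_apply]
    rw [fderiv_comp _ (hf _) ((hf.iterate m) _), ContinuousLinearMap.comp_assoc]

/-- The frame lift of a vector field with integral curves on `[0, 1]` has such curves too: the
linear part solves the variational equation. -/
theorem IsUnitFlow.exists_frameLift [FiniteDimensional ℝ E] {Y : E → E} {Φ : ℝ → E → E}
    (hΦ : IsUnitFlow Y Φ) (hY : ContDiff ℝ ∞ Y) :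
    ∃ Ψ : ℝ → E → (E →L[ℝ] E),
      IsUnitFlow (frameLift Y) (fun t q => (Φ t q.1, (Ψ t q.1).comp q.2)) := by
  have key : ∀ x, ∃ z : ℝ → (E →L[ℝ] E), z 0 = ContinuousLinearMap.id ℝ E ∧
      ∀ t ∈ Icc (0 : ℝ) 1,
        HasDerivWithinAt z ((fderiv ℝ Y (Φ t x)).comp (z t)) (Icc 0 1) t := fun x => by
    refine exists_linear_ode (B := fun t => ContinuousLinearMap.compL ℝ E E E
      (fderiv ℝ Y (Φ t x))) ?_ _
    refine (ContinuousLinearMap.compL ℝ E E E).continuous.comp_continuousOn ?_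
    exact (hY.continuous_fderiv (by simp)).comp_continuousOn
      fun t ht => ((hΦ x).2 t ht).continuousWithinAt
  choose z hz0 hz using key
  refine ⟨fun t x => z x t, fun q => ⟨?_, fun t ht => ?_⟩⟩
  · simp [(hΦ q.1).1, hz0]
  · refine ((hΦ q.1).2 t ht).prodMk ?_
    have := ((ContinuousLinearMap.compL ℝ E E E).flip q.2).hasFDerivAt.comp_hasDerivWithinAt t
      (hz q.1 t ht)
    exact this

end Lift

/-- The limit of a continuously convergent family is continuous. -/
theorem continuous_of_forall_tendsto_prod {ι X Z : Type*} [TopologicalSpace X] [TopologicalSpace Z]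
    [RegularSpace Z] {l : Filter ι} [l.NeBot] {f : ι → X → Z} {g : X → Z}
    (h : ∀ x, Tendsto (fun q : ι × X => f q.1 q.2) (l ×ˢ 𝓝 x) (𝓝 (g x))) : Continuous g := by
  refine continuous_iff_continuousAt.2 fun x => ?_
  refine ((closed_nhds_basis (g x)).tendsto_right_iff).2 fun V hV => ?_
  obtain ⟨pa, ha, pb, hb, hab⟩ := Filter.eventually_prod_iff.1 ((h x).eventually hV.1)
  filter_upwards [hb] with y hy
  exact hV.2.mem_of_tendsto ((h y).comp (tendsto_id.prodMk tendsto_const_nhds))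
    (ha.mono fun i hi => hab hi hy)

theorem tendstoUniformlyOnFilter_of_forall_tendsto {ι X Z : Type*} [TopologicalSpace X]
    [PseudoMetricSpace Z] {l : Filter ι} [l.NeBot] {f : ι → X → Z} {g : X → Z}
    (h : ∀ x, Tendsto (fun q : ι × X => f q.1 q.2) (l ×ˢ 𝓝 x) (𝓝 (g x))) {x : X} :
    TendstoUniformlyOnFilter f g l (𝓝 x) := by
  rw [Metric.tendstoUniformlyOnFilter_iff]
  intro ε hε
  have hg : Tendsto (fun q : ι × X => g q.2) (l ×ˢ 𝓝 x) (𝓝 (g x)) :=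
    ((continuous_of_forall_tendsto_prod h).tendsto x).comp tendsto_snd
  have := hg.dist (h x)
  rw [dist_self] at this
  exact this.eventually (gt_mem_nhds hε)

/-! ### Convergence of one-step schemes with all derivatives -/

section SmoothEuler

variable {E : Type} [NormedAddCommGroup E] [NormedSpace ℝ E]

/-- The rescaled displacement `m (F m - id)` of a one-step scheme `F`. -/
noncomputable def stepQuotient (F : ℕ → E → E) (m : ℕ) (x : E) : E := (m : ℝ) • (F m x - x)

/-- The fibre component of the lifted quotient is `m (DF m - id) ∘ A`, the derivative of the
original quotient composed with `A`. One order is spent on it. -/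
theorem SmoothConv.stepQuotient_frameLift {l : Filter ℕ} {r : ℕ} {F : ℕ → E → E} {Y : E → E}
    (hF : ∀ m, ContDiff ℝ ∞ (F m)) {q : E × (E →L[ℝ] E)}
    (h : SmoothConv l (r + 1) (stepQuotient F) Y q.1) :
    SmoothConv l r (stepQuotient fun m => frameLift (F m)) (frameLift Y) q := by
  have h1 : SmoothConv l r (fun m (p : E × (E →L[ℝ] E)) => stepQuotient F m p.1)
      (fun p => Y p.1) q := SmoothConv.comp_right h.of_succ contDiff_fst.contDiffAt
  have h2 : SmoothConv l r (fun m (p : E × (E →L[ℝ] E)) => fderiv ℝ (stepQuotient F m) p.1)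
      (fun p => fderiv ℝ Y p.1) q := SmoothConv.comp_right h.2.2.2 contDiff_fst.contDiffAt
  have h3 := h2.prodMk (SmoothConv.const (l := l) (r := r) (x := q)
    (contDiff_snd (𝕜 := ℝ) (E := E) (F := E →L[ℝ] E)).contDiffAt)
  have h4 := SmoothConv.comp_left
    (g := fun p : (E →L[ℝ] E) × (E →L[ℝ] E) => p.1.comp p.2)
    (isBoundedBilinearMap_comp.contDiff.contDiffAt) h3
  refine (h1.prodMk h4).congr (Eventually.of_forall ?_) (Eventually.of_forall fun p => rfl)
  rintro ⟨m, x, A⟩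
  have hd : fderiv ℝ (stepQuotient F m) x
      = (m : ℝ) • (fderiv ℝ (F m) x - ContinuousLinearMap.id ℝ E) :=
    ((((hF m).differentiable (by simp) x).hasFDerivAt.sub (hasFDerivAt_id x)).const_smul
      (m : ℝ)).fderiv
  simp only [hd]
  simp [stepQuotient, frameLift, ContinuousLinearMap.sub_comp]

/-- A one-step scheme that is consistent with `Y` in the `C^r` sense converges to the time-one map
of `Y` in the `C^r` sense. -/
theorem SmoothConv.iterate_euler [FiniteDimensional ℝ E] {Y : E → E} {Φ : ℝ → E → E}
    (hY : ContDiff ℝ ∞ Y) (hΦ : IsUnitFlow Y Φ) {F : ℕ → E → E} (hF : ∀ m, ContDiff ℝ ∞ (F m))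
    {r : ℕ} (h : ∀ y, SmoothConv atTop r (stepQuotient F) Y y) (x : E) :
    SmoothConv atTop r (fun m => (F m)^[m]) (Φ 1) x := by
  induction r generalizing E with
  | zero =>
    have := tendsto_iterate_euler (hY.of_le (by simp)) (hΦ x).2 (fun y => (h y).tendsto)
    rwa [(hΦ x).1] at this
  | succ r ih =>
    obtain ⟨Ψ, hΨ⟩ := hΦ.exists_frameLift hY
    have h0 := fun x => tendsto_iterate_euler (hY.of_le (by simp)) (hΦ x).2
      (fun y => (h y).tendsto)
    simp only [fun x => (hΦ x).1] at h0
    -- The induction hypothesis is used on the larger space of pairs `(x, A)`; setting `A = id` and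
    -- projecting gives the derivatives of the iterates.
    have hJ := ih hY.frameLift hΨ (fun m => (hF m).frameLift)
      (fun q => stepQuotient_frameLift hF (h q.1))
    have hdiff : ∀ m, Differentiable ℝ ((F m)^[m]) := fun m =>
      ((hF m).differentiable (by simp)).iterate m
    have hd : ∀ x, SmoothConv atTop r (fun m => fderiv ℝ ((F m)^[m])) (Ψ 1) x := fun x => by
      have h1 := (hJ (x, ContinuousLinearMap.id ℝ E)).comp_right
        (g' := fun y : E => (y, ContinuousLinearMap.id ℝ E))
        (contDiff_id.prodMk contDiff_const).contDiffAt
      have h2 := SmoothConv.clm_comp (ContinuousLinearMap.snd ℝ E (E →L[ℝ] E)) h1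
      refine h2.congr (Eventually.of_forall fun q => ?_) (Eventually.of_forall fun y => ?_)
      · simp [iterate_frameLift ((hF q.1).differentiable (by simp)), frameLift]
      · simp
    have hlim : ∀ x, HasFDerivAt (Φ 1) (Ψ 1 x) x := fun x => by
      refine hasFDerivAt_of_tendstoUniformlyOnFilter (l := atTop)
        (f := fun m => (F m)^[m]) (f' := fun m => fderiv ℝ ((F m)^[m])) ?_
        (Eventually.of_forall fun q => (hdiff q.1 q.2).hasFDerivAt)
        (Eventually.of_forall fun y => ?_)
      · exact tendstoUniformlyOnFilter_of_forall_tendsto fun x => (hd x).tendsto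
      · exact (h0 y).comp (tendsto_id.prodMk tendsto_const_nhds)
    have hfd : fderiv ℝ (Φ 1) = Ψ 1 := funext fun x => (hlim x).fderiv
    refine ⟨h0 x, Eventually.of_forall fun q => hdiff q.1 q.2,
      Eventually.of_forall fun y => (hlim y).differentiableAt, ?_⟩
    rw [hfd]
    exact hd x

/-- The time-one map of a smooth vector field with integral curves on `[0, 1]` is smooth. -/
theorem IsUnitFlow.contDiff [FiniteDimensional ℝ E] {Y : E → E} {Φ : ℝ → E → E}
    (hΦ : IsUnitFlow Y Φ) (hY : ContDiff ℝ ∞ Y) : ContDiff ℝ ∞ (Φ 1) := by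
  refine contDiff_infty.2 fun r => ?_
  refine SmoothConv.contDiff (l := atTop) (f := fun m : ℕ => (fun x => x + (m : ℝ)⁻¹ • Y x)^[m])
    (SmoothConv.iterate_euler (F := fun m x => x + (m : ℝ)⁻¹ • Y x) hY hΦ (fun m => ?_) fun y => ?_)
  · exact contDiff_id.add (contDiff_const.smul hY)
  · refine (SmoothConv.const (hY.contDiffAt.of_le (by exact_mod_cast le_top))).congr ?_
      (EventuallyEq.refl _ _)
    filter_upwards [tendsto_fst.eventually (eventually_gt_atTop 0)] with q hq
    have : (q.1 : ℝ) ≠ 0 := by positivity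
    simp [stepQuotient, smul_smul, this]

/-- Compactly supported vector fields have integral curves. -/
theorem exists_isUnitFlow {E : Type*} [NormedAddCommGroup E] [NormedSpace ℝ E]
    [FiniteDimensional ℝ E] {Y : E → E} (hY : ContDiff ℝ ∞ Y) (hs : HasCompactSupport Y) :
    ∃ Φ : ℝ → E → E, IsUnitFlow Y Φ := by
  obtain ⟨K, hK⟩ := hY.lipschitzWith_of_hasCompactSupport hs (by simp)
  obtain ⟨D, hD⟩ := hs.exists_bound_of_continuous hY.continuous
  have := fun x => exists_integralCurve_of_bounded (f := fun _ => Y) (K := K) (L := D.toNNReal)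
    (fun _ _ => hK) (fun _ => continuousOn_const)
    (fun _ _ x => (hD x).trans (Real.le_coe_toNNReal D)) x
  choose z hz0 hz using this
  exact ⟨fun t x => z x t, fun x => ⟨hz0 x, hz x⟩⟩

end SmoothEuler

/-! ### Hadamard's lemma and rescaled limits -/

section Hadamard

/-- Smooth dependence of an integral on parameters. -/
theorem ContDiff.intervalIntegral {X : Type} [NormedAddCommGroup X] [NormedSpace ℝ X]
    [FiniteDimensional ℝ X] {n : ℕ} {F : Type} [NormedAddCommGroup F] [NormedSpace ℝ F]
    {f : X × ℝ → F} (hf : ContDiff ℝ n f) :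
    ContDiff ℝ n (fun x => ∫ s in (0 : ℝ)..1, f (x, s)) := by
  induction n generalizing F with
  | zero =>
    refine contDiff_zero.2 (intervalIntegral.continuous_parametric_intervalIntegral_of_continuous'
      (f := fun x s => f (x, s)) ?_ _ _)
    exact hf.continuous
  | succ n ih =>
    have hf1 : ContDiff ℝ n (fderiv ℝ f) := hf.fderiv_right (by simp)
    have hf' : ContDiff ℝ n
        (fun p : X × ℝ => (fderiv ℝ f p).comp (ContinuousLinearMap.inl ℝ X ℝ)) :=
      hf1.clm_comp contDiff_const
    have hfd : ∀ x s, HasFDerivAt (fun y => f (y, s))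
        ((fderiv ℝ f (x, s)).comp (ContinuousLinearMap.inl ℝ X ℝ)) x := fun x s =>
      (hf.differentiable (by simp) (x, s)).hasFDerivAt.comp x (hasFDerivAt_prodMk_left x s)
    have key : ∀ x, HasFDerivAt (fun x => ∫ s in (0 : ℝ)..1, f (x, s))
        (∫ s in (0 : ℝ)..1, (fderiv ℝ f (x, s)).comp (ContinuousLinearMap.inl ℝ X ℝ)) x := by
      intro x
      obtain ⟨C, hC⟩ := ((isCompact_closedBall x 1).prod
        (isCompact_Icc (a := (0 : ℝ)) (b := 1))).exists_bound_of_continuousOn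
        hf'.continuous.continuousOn
      have hc : Continuous f := hf.continuous
      have hc' := hf'.continuous
      refine intervalIntegral.hasFDerivAt_integral_of_dominated_of_fderiv_le
        (F := fun x s => f (x, s))
        (F' := fun x s => (fderiv ℝ f (x, s)).comp (ContinuousLinearMap.inl ℝ X ℝ))
        (bound := fun _ => C) (Metric.closedBall_mem_nhds x one_pos)
        (Eventually.of_forall fun y => ?_) ?_ ?_ ?_ ?_ ?_
      · exact (hc.comp (by fun_prop : Continuous fun s : ℝ => (y, s))).aestronglyMeasurable
      · exact (hc.comp (by fun_prop : Continuous fun s : ℝ => (x, s))).intervalIntegrable _ _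
      · exact (hc'.comp (by fun_prop : Continuous fun s : ℝ => (x, s))).aestronglyMeasurable
      · refine Eventually.of_forall fun s hs y hy => hC (y, s) ⟨hy, ?_⟩
        rw [uIoc_of_le zero_le_one] at hs
        exact Ioc_subset_Icc_self hs
      · exact intervalIntegrable_const
      · exact Eventually.of_forall fun s _ y _ => hfd y s
    have hn : ((n : WithTop ℕ∞) = ω) → AnalyticOnNhd ℝ
        (fun x => ∫ s in (0 : ℝ)..1, f (x, s)) univ := fun h => by cases h
    refine (contDiff_succ_iff_fderiv (n := (n : WithTop ℕ∞))).2 ⟨fun x => (key x).differentiableAt,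
        hn, ?_⟩
    rw [show fderiv ℝ (fun x => ∫ s in (0 : ℝ)..1, f (x, s)) = _ from
      funext fun x => (key x).fderiv]
    exact ih hf'

variable {E F : Type} [NormedAddCommGroup E] [NormedSpace ℝ E] [NormedAddCommGroup F]
  [NormedSpace ℝ F]

theorem SmoothConv.const_tendsto {ι : Type*} {l : Filter ι} {c : ι → F} {c₀ : F}
    (h : Tendsto c l (𝓝 c₀)) (r : ℕ) (x : E) : SmoothConv l r (fun i _ => c i) (fun _ => c₀) x := by
  have h0 : Tendsto (fun q : ι × E => c q.1) (l ×ˢ 𝓝 x) (𝓝 c₀) := h.comp tendsto_fst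
  cases r with
  | zero => exact h0
  | succ r =>
    refine ⟨h0, Eventually.of_forall fun _ => differentiableAt_const _,
      Eventually.of_forall fun _ => differentiableAt_const _, ?_⟩
    simp only [fderiv_fun_const]
    exact SmoothConv.const contDiffAt_const

variable [FiniteDimensional ℝ E] [CompleteSpace F]

/-- Hadamard's lemma in the first variable. -/
theorem exists_contDiff_eq_smul {f : ℝ × E → F} (hf : ContDiff ℝ ∞ f) (h0 : ∀ x, f (0, x) = 0) :
    ∃ g : ℝ × E → F, ContDiff ℝ ∞ g ∧ ∀ t x, f (t, x) = t • g (t, x) := by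
  -- Fundamental theorem of calculus for `s ↦ f (s * t, x)`.
  refine ⟨fun q => ∫ s in (0 : ℝ)..1, fderiv ℝ f (s * q.1, q.2) (1, 0), ?_, fun t x => ?_⟩
  · refine contDiff_infty.2 fun n => ?_
    refine ContDiff.intervalIntegral (f := fun p : (ℝ × E) × ℝ =>
      fderiv ℝ f (p.2 * p.1.1, p.1.2) (1, 0)) ?_
    have h1 : ContDiff ℝ n (fderiv ℝ f) := (hf.fderiv_right (m := ∞) (by simp)).of_le
        (by exact_mod_cast le_top)
    fun_prop
  · have hd : ∀ s ∈ uIcc (0 : ℝ) 1, HasDerivAt (fun s : ℝ => f (s * t, x))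
        (t • fderiv ℝ f (s * t, x) (1, 0)) s := fun s _ => by
      have h1 : HasDerivAt (fun s : ℝ => (s * t, x)) (t, 0) s := by
        simpa using ((hasDerivAt_id s).mul_const t).prodMk (hasDerivAt_const s x)
      have h2 := ((hf.differentiable (by simp) (s * t, x)).hasFDerivAt).comp_hasDerivAt s h1
      rwa [show ((t, 0) : ℝ × E) = t • ((1 : ℝ), (0 : E)) by simp, map_smul] at h2
    have hc : Continuous fun s : ℝ => t • fderiv ℝ f (s * t, x) (1, 0) := by
      have h1 : Continuous (fderiv ℝ f) := hf.continuous_fderiv (by simp)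
      fun_prop
    have := intervalIntegral.integral_eq_sub_of_hasDerivAt hd (hc.intervalIntegrable _ _)
    simp only [one_mul, zero_mul, h0, sub_zero] at this
    rw [← this, intervalIntegral.integral_smul]

/-- A smooth map that vanishes to order `k` in the first variable is divisible by `t ^ k`. -/
theorem exists_contDiff_eq_pow_smul (k : ℕ) {f : ℝ × E → F} (hf : ContDiff ℝ ∞ f) {W : E → F}
    (h : ∀ x, Tendsto (fun t : ℝ => (t ^ k)⁻¹ • f (t, x)) (𝓝[>] 0) (𝓝 (W x))) :
    ∃ g : ℝ × E → F, ContDiff ℝ ∞ g ∧ (∀ t x, f (t, x) = t ^ k • g (t, x)) ∧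
      ∀ x, g (0, x) = W x := by
  have hlim : ∀ {f : ℝ × E → F} (_ : ContDiff ℝ ∞ f) (x : E),
      Tendsto (fun t : ℝ => f (t, x)) (𝓝[>] 0) (𝓝 (f (0, x))) := fun hf x =>
    (Continuous.tendsto (by have := hf.continuous; fun_prop) 0).mono_left nhdsWithin_le_nhds
  induction k generalizing f with
  | zero =>
    refine ⟨f, hf, by simp, fun x => ?_⟩
    have := h x
    simp only [pow_zero, inv_one, one_smul] at this
    exact tendsto_nhds_unique (hlim hf x) this
  | succ k ih =>
    have h0 : ∀ x, f (0, x) = 0 := fun x => by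
      have h1 : Tendsto (fun t : ℝ => t ^ (k + 1)) (𝓝[>] 0) (𝓝 0) :=
        (Continuous.tendsto' (by fun_prop) _ _ (by simp)).mono_left nhdsWithin_le_nhds
      have h2 := h1.smul (h x)
      rw [zero_smul] at h2
      refine tendsto_nhds_unique (hlim hf x) (h2.congr' ?_)
      filter_upwards [self_mem_nhdsWithin] with t ht
      exact smul_inv_smul₀ (pow_ne_zero _ (ne_of_gt ht)) _
    obtain ⟨g, hg, hfg⟩ := exists_contDiff_eq_smul hf h0
    obtain ⟨D, hD, hgD, hDW⟩ := ih hg fun x => (h x).congr' (by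
      filter_upwards [self_mem_nhdsWithin] with t ht
      have ht : t ≠ 0 := ne_of_gt ht
      rw [hfg, smul_smul, pow_succ]
      congr 1
      field_simp)
    exact ⟨D, hD, fun t x => by rw [hfg, hgD, smul_smul, pow_succ'], hDW⟩

/-- Rescaled limits at `t = 0` of a smooth family hold in the `C^r` sense. -/
theorem SmoothConv.of_tendsto_pow_smul {k : ℕ} {u : ℝ × E → F} {x₀ : E}
    (hu : ∀ᶠ q in 𝓝 ((0 : ℝ), x₀), ContDiffAt ℝ ∞ u q) {W : E → F}
    (h : ∀ᶠ x in 𝓝 x₀, Tendsto (fun t : ℝ => (t ^ k)⁻¹ • u (t, x)) (𝓝[>] 0) (𝓝 (W x)))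
    {ι : Type*} {l : Filter ι} {τ : ι → ℝ} (hτ : Tendsto τ l (𝓝[>] 0)) (r : ℕ) :
    SmoothConv l r (fun i x => (τ i ^ k)⁻¹ • u (τ i, x)) W x₀ := by
  obtain ⟨ε, hε, hball⟩ := Metric.eventually_nhds_iff_ball.1 (hu.and
    ((continuous_snd.tendsto ((0 : ℝ), x₀)).eventually h))
  -- The bump makes `u` globally smooth, as Hadamard's lemma requires, and changes nothing near `(0,
  -- x₀)`.
  let β : ContDiffBump ((0 : ℝ), x₀) := ⟨ε / 3, ε / 2, by linarith, by linarith⟩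
  have hf : ContDiff ℝ ∞ (fun q => β q • u q) := by
    refine contDiff_iff_contDiffAt.2 fun q => ?_
    by_cases hq : q ∈ Metric.ball ((0 : ℝ), x₀) ε
    · exact β.contDiff.contDiffAt.smul (hball q hq).1
    · refine (contDiffAt_const (c := (0 : F))).congr_of_eventuallyEq ?_
      have : (Metric.closedBall ((0 : ℝ), x₀) (ε / 2))ᶜ ∈ 𝓝 q :=
        Metric.isClosed_closedBall.isOpen_compl.mem_nhds fun hq' =>
          hq (Metric.closedBall_subset_ball (by linarith) hq')
      filter_upwards [this] with p hp
      rw [β.zero_of_le_dist (by simpa [β] using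
          (not_le.1 (fun h => hp (Metric.mem_closedBall.2 h))).le), zero_smul]
  have hW : ∀ x, Tendsto (fun t : ℝ => (t ^ k)⁻¹ • (β (t, x) • u (t, x))) (𝓝[>] 0)
      (𝓝 (β (0, x) • W x)) := fun x => by
    by_cases hx : dist x x₀ < ε
    · have h1 := (hball (0, x) (by simpa [Prod.dist_eq, hε] using hx)).2
      have h2 : Tendsto (fun t : ℝ => β (t, x)) (𝓝[>] 0) (𝓝 (β (0, x))) :=
        (Continuous.tendsto (by have := β.continuous; fun_prop) 0).mono_left nhdsWithin_le_nhds
      refine (h2.smul h1).congr fun t => smul_comm _ _ _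
    · have : ∀ t : ℝ, β (t, x) = 0 := fun t => β.zero_of_le_dist (by
        refine le_trans ?_ (le_max_right _ _)
        simp only [β]
        linarith)
      simp [this]
  obtain ⟨D, hD, hfD, hDW⟩ := exists_contDiff_eq_pow_smul k hf hW
  have h1 : SmoothConv l r (fun i x => (τ i, x)) (fun x => ((0 : ℝ), x)) x₀ :=
    (SmoothConv.const_tendsto (hτ.mono_right nhdsWithin_le_nhds) r x₀).prodMk
      (SmoothConv.const contDiffAt_id)
  -- The quotient `D` is jointly smooth, so substituting `t = τ i → 0` converges with all
  -- derivatives in `x`.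
  have h2 := SmoothConv.comp_left (g := D) (hD.contDiffAt.of_le (by exact_mod_cast le_top)) h1
  refine h2.congr ?_ ?_
  · have h3 : Tendsto (fun q : ι × E => (τ q.1, q.2)) (l ×ˢ 𝓝 x₀) (𝓝 ((0 : ℝ), x₀)) := h1.tendsto
    filter_upwards [h3.eventually β.eventuallyEq_one,
      (hτ.comp tendsto_fst).eventually self_mem_nhdsWithin] with q hq hq'
    have hq' : τ q.1 ≠ 0 := ne_of_gt hq'
    have := hfD (τ q.1) q.2
    rw [hq, Pi.one_apply, one_smul] at this
    rw [this, inv_smul_smul₀ (pow_ne_zero _ hq')]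
  · have h3 : Tendsto (fun x : E => ((0 : ℝ), x)) (𝓝 x₀) (𝓝 ((0 : ℝ), x₀)) :=
      Continuous.tendsto (by fun_prop) _
    filter_upwards [h3.eventually β.eventuallyEq_one] with x hx
    rw [hDW, hx, Pi.one_apply, one_smul]

end Hadamard

/-! ### Curves with vanishing lower derivatives -/

section Taylor

open scoped Nat

variable {E F : Type*} [NormedAddCommGroup E] [NormedSpace ℝ E] [NormedAddCommGroup F]
  [NormedSpace ℝ F]

/-- In the Taylor polynomial of degree `k` only the constant and the top term survive. -/
theorem tendsto_pow_smul_sub_of_iteratedDeriv {k : ℕ} (hk : 1 ≤ k) {c : ℝ → E}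
    (hc : ContDiffAt ℝ k c 0) (h0 : ∀ j, 1 ≤ j → j < k → iteratedDeriv j c 0 = 0) :
    Tendsto (fun t : ℝ => (t ^ k)⁻¹ • (c t - c 0)) (𝓝[>] 0)
      (𝓝 ((k ! : ℝ)⁻¹ • iteratedDeriv k c 0)) := by
  obtain ⟨δ, hδ, hball⟩ := Metric.eventually_nhds_iff_ball.1 (hc.eventually (by simp))
  have hcon : ContDiffOn ℝ k c (Metric.ball 0 δ) := fun t ht => (hball t ht).contDiffWithinAt
  have hmem : (0 : ℝ) ∈ Metric.ball (0 : ℝ) δ := Metric.mem_ball_self hδ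
  have h1 := (taylor_tendsto (convex_ball (0 : ℝ) δ) hmem hcon).mono_left
    (nhdsWithin_le_of_mem (nhdsWithin_le_nhds (Metric.ball_mem_nhds _ hδ)) : 𝓝[>] (0 : ℝ) ≤ _)
  have hT : ∀ t, taylorWithinEval c k (Metric.ball 0 δ) 0 t
      = c 0 + t ^ k • ((k ! : ℝ)⁻¹ • iteratedDeriv k c 0) := fun t => by
    rw [taylor_within_apply, Finset.sum_range_succ, Finset.sum_eq_single_of_mem 0 (by simp; omega)]
    · rw [iteratedDerivWithin_of_isOpen Metric.isOpen_ball hmem]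
      rw [iteratedDerivWithin_of_isOpen Metric.isOpen_ball hmem]
      simp [smul_smul, mul_comm]
    · intro j hj hj0
      rw [iteratedDerivWithin_of_isOpen Metric.isOpen_ball hmem,
        h0 j (by omega) (by simpa using hj), smul_zero]
  have h2 := h1.add_const ((k ! : ℝ)⁻¹ • iteratedDeriv k c 0)
  rw [zero_add] at h2
  refine h2.congr' ?_
  filter_upwards [self_mem_nhdsWithin] with t ht
  have ht : t ≠ 0 := ne_of_gt ht
  rw [hT, sub_zero, ← sub_sub, smul_sub _ (c t - c 0), inv_smul_smul₀ (pow_ne_zero _ ht)]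
  abel

/-- Since `c t - c 0` is of order `t ^ k`, the error of the linear approximation of `g` is `o(t ^
k)`. Thus a `k`-th order tangent transforms under `g` like an ordinary tangent vector. -/
theorem HasFDerivAt.tendsto_pow_smul_sub {k : ℕ} (hk : 1 ≤ k) {c : ℝ → E} {g : E → F}
    {g' : E →L[ℝ] F} (hg : HasFDerivAt g g' (c 0))
    (hc : ContDiffAt ℝ k c 0) (h0 : ∀ j, 1 ≤ j → j < k → iteratedDeriv j c 0 = 0) :
    Tendsto (fun t : ℝ => (t ^ k)⁻¹ • (g (c t) - g (c 0))) (𝓝[>] 0)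
      (𝓝 ((k ! : ℝ)⁻¹ • g' (iteratedDeriv k c 0))) := by
  have hd : Tendsto (fun t => c t - c 0) (𝓝[>] 0) (𝓝 0) := by
    have := (hc.continuousAt.tendsto.sub_const (c 0)).mono_left
      (nhdsWithin_le_nhds (s := Ioi (0 : ℝ)))
    rwa [sub_self] at this
  have := (hasFDerivWithinAt_univ.2 hg).lim hd (Eventually.of_forall fun _ => mem_univ _)
    (tendsto_pow_smul_sub_of_iteratedDeriv hk hc h0)
  rw [map_smul] at this
  simpa using this

end Taylor

/-! ### Embedding of `M` and extension to the ambient space -/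

namespace DiffTangent

variable {n : ℕ} {M : Type*} [TopologicalSpace M] [ChartedSpace (EuclideanSpace ℝ (Fin n)) M]

variable (n M) in
/-- Finitely many charts of `M` with a partition of unity `ρ` subordinate to them, and cutoff
functions `f` supported in the chart domains that are `1` near the support of `ρ`. -/
structure ChartCutoffs (N : ℕ) where
  center : Fin N → M
  f : Fin N → M → ℝ
  ρ : Fin N → M → ℝ
  contMDiff_f : ∀ i, ContMDiff (𝓡 n) 𝓘(ℝ, ℝ) ∞ (f i)
  contMDiff_ρ : ∀ i, ContMDiff (𝓡 n) 𝓘(ℝ, ℝ) ∞ (ρ i)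
  tsupport_f : ∀ i, tsupport (f i) ⊆ (chartAt (EuclideanSpace ℝ (Fin n)) (center i)).source
  eventually_f : ∀ i p, ρ i p ≠ 0 → ∀ᶠ q in 𝓝 p, f i q = 1
  sum_ρ : ∀ p, ∑ i, ρ i p = 1

variable (n M) in
theorem exists_chartCutoffs [T2Space M] [CompactSpace M] [IsManifold (𝓡 n) ∞ M] :
    ∃ N, Nonempty (ChartCutoffs n M N) := by
  obtain ⟨t, ht⟩ := isCompact_univ.elim_nhds_subcover
    (fun p : M => (chartAt (EuclideanSpace ℝ (Fin n)) p).source)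
    (fun p _ => chart_source_mem_nhds _ p)
  let c : Fin t.card → M := fun i => t.equivFin.symm i
  have hcov : (univ : Set M) ⊆ ⋃ i, (chartAt (EuclideanSpace ℝ (Fin n)) (c i)).source :=
    fun p hp => by
      obtain ⟨q, hq, hpq⟩ := mem_iUnion₂.1 (ht.2 hp)
      exact mem_iUnion.2 ⟨t.equivFin ⟨q, hq⟩, by simpa [c] using hpq⟩
  obtain ⟨ρ, hρ⟩ := SmoothPartitionOfUnity.exists_isSubordinate (𝓡 n) isClosed_univ _
    (fun i => (chartAt (EuclideanSpace ℝ (Fin n)) (c i)).open_source) hcov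
  have key : ∀ i, ∃ f : M → ℝ, ContMDiff (𝓡 n) 𝓘(ℝ, ℝ) ∞ f ∧
      tsupport f ⊆ (chartAt (EuclideanSpace ℝ (Fin n)) (c i)).source ∧
      ∀ᶠ q in 𝓝ˢ (tsupport (ρ i)), f q = 1 := fun i => by
    obtain ⟨u, hu, h1, h2⟩ := normal_exists_closure_subset (isClosed_tsupport (ρ i))
      (chartAt (EuclideanSpace ℝ (Fin n)) (c i)).open_source (hρ i)
    obtain ⟨f, hf1, hf0, -⟩ := exists_contMDiffMap_one_nhds_of_subset_interior (𝓡 n) (n := (⊤ : ℕ∞))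
      (isClosed_tsupport (ρ i)) (h1.trans (interior_maximal subset_closure hu))
    refine ⟨f, f.contMDiff, (closure_minimal (fun q hq => ?_) isClosed_closure).trans h2, hf1⟩
    by_contra hq'
    exact hq (hf0 q hq')
  choose f hf hfs hf1 using key
  exact ⟨_, ⟨{
    center := c
    f := f
    ρ := fun i => ρ i
    contMDiff_f := hf
    contMDiff_ρ := fun i => (ρ i).contMDiff
    tsupport_f := hfs
    eventually_f := fun i p hp => (hf1 i).filter_mono
      (nhds_le_nhdsSet (subset_tsupport (ρ i) hp))
    sum_ρ := fun p => by
      rw [← finsum_eq_sum_of_fintype]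
      exact ρ.sum_eq_one (mem_univ p) }⟩⟩

/-- The space `(ℝⁿ × ℝ)^N` into which `M` is embedded. -/
abbrev Ambient (n N : ℕ) : Type := Fin N → EuclideanSpace ℝ (Fin n) × ℝ

theorem contDiffAt_comp_symm [IsManifold (𝓡 n) ∞ M] {F : Type*} [NormedAddCommGroup F]
    [NormedSpace ℝ F] {φ : OpenPartialHomeomorph M (EuclideanSpace ℝ (Fin n))}
    (hφ : φ ∈ IsManifold.maximalAtlas (𝓡 n) ∞ M) {x : EuclideanSpace ℝ (Fin n)} (hx : x ∈ φ.target)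
    {h : M → F} (hh : ContMDiffAt (𝓡 n) 𝓘(ℝ, F) ∞ h (φ.symm x)) :
    ContDiffAt ℝ ∞ (fun y => h (φ.symm y)) x :=
  contMDiffAt_iff_contDiffAt.1 (hh.comp x (contMDiffAt_symm_of_mem_maximalAtlas hφ hx))

namespace ChartCutoffs

variable {N : ℕ} (C : ChartCutoffs n M N)

/-- The `i`-th chart. -/
abbrev chart (i : Fin N) : OpenPartialHomeomorph M (EuclideanSpace ℝ (Fin n)) :=
  chartAt (EuclideanSpace ℝ (Fin n)) (C.center i)

/-- The embedding of `M`. -/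
noncomputable def emb (p : M) : Ambient n N := fun i => (C.f i p • C.chart i p, C.ρ i p)

theorem exists_ρ_ne_zero (p : M) : ∃ i, C.ρ i p ≠ 0 := by
  by_contra! h
  simpa [h] using C.sum_ρ p

theorem f_eq_one {i : Fin N} {p : M} (h : C.ρ i p ≠ 0) : C.f i p = 1 :=
  (C.eventually_f i p h).self_of_nhds

theorem mem_source {i : Fin N} {p : M} (h : C.ρ i p ≠ 0) : p ∈ (C.chart i).source :=
  C.tsupport_f i (subset_tsupport _ (by simp [C.f_eq_one h]))

theorem emb_fst {i : Fin N} {p : M} (h : C.ρ i p ≠ 0) : (C.emb p i).1 = C.chart i p := by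
  simp [emb, C.f_eq_one h]

/-- The `ρ`-coordinates single out a chart containing both points, and there the cutoff is `1`, so
the embedding records the chart coordinates. -/
theorem emb_injective : Function.Injective C.emb := by
  intro p q h
  obtain ⟨i, hi⟩ := C.exists_ρ_ne_zero p
  have hq : C.ρ i q ≠ 0 := by
    rw [← show C.ρ i p = C.ρ i q from congrArg (fun y => (y i).2) h]
    exact hi
  refine (C.chart i).injOn (C.mem_source hi) (C.mem_source hq) ?_
  rw [← C.emb_fst hi, ← C.emb_fst hq, h]

/-- `h`, cut off by `f i` and read in the `i`-th chart. -/
noncomputable def localExt {F : Type*} [NormedAddCommGroup F] [NormedSpace ℝ F] (i : Fin N)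
    (h : M → F) : EuclideanSpace ℝ (Fin n) → F :=
  (C.chart i).target.indicator fun x => C.f i ((C.chart i).symm x) • h ((C.chart i).symm x)

/-- Extension of `h` from `M` to the ambient space, with cutoff `β`. -/
noncomputable def ext {F : Type*} [NormedAddCommGroup F] [NormedSpace ℝ F] (β : Ambient n N → ℝ)
    (h : M → F) : Ambient n N → F :=
  fun y => β y • ∑ i, (y i).2 • C.localExt i h (y i).1

section

variable {F : Type*} [NormedAddCommGroup F] [NormedSpace ℝ F]

/-- On the image of `M` the `i`-th term equals `ρ i p • h p`, because the cutoff is `1` wherever `ρ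
i` does not vanish. -/
theorem ext_emb {β : Ambient n N → ℝ} {p : M} (hβ : β (C.emb p) = 1) (h : M → F) :
    C.ext β h (C.emb p) = h p := by
  have : ∀ i, (C.emb p i).2 • C.localExt i h (C.emb p i).1 = C.ρ i p • h p := fun i => by
    by_cases hi : C.ρ i p = 0
    · simp [emb, hi]
    · rw [C.emb_fst hi, localExt, indicator_of_mem ((C.chart i).map_source (C.mem_source hi)),
        (C.chart i).left_inv (C.mem_source hi), C.f_eq_one hi, one_smul]
      rfl
  simp only [ext, hβ, one_smul, this]
  rw [← Finset.sum_smul, C.sum_ρ, one_smul]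

theorem hasCompactSupport_ext {β : Ambient n N → ℝ} (hβ : HasCompactSupport β) (h : M → F) :
    HasCompactSupport (C.ext β h) :=
  hβ.smul_right

theorem localExt_eventuallyEq {i : Fin N} {x : EuclideanSpace ℝ (Fin n)}
    (hx : x ∈ (C.chart i).target) : ∀ᶠ y in 𝓝 x, ∀ h : M → F,
      C.localExt i h y = C.f i ((C.chart i).symm y) • h ((C.chart i).symm y) := by
  filter_upwards [(C.chart i).open_target.mem_nhds hx] with y hy h
  exact indicator_of_mem hy _

/-- The chart image of the support of `f i` is compact, hence closed in all of `ℝⁿ`; extension by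
zero is therefore smooth at the boundary of the chart target. -/
theorem localExt_eventuallyEq_zero [CompactSpace M] {i : Fin N} {x : EuclideanSpace ℝ (Fin n)}
    (hx : x ∉ (C.chart i).target) : ∀ᶠ y in 𝓝 x, ∀ h : M → F, C.localExt i h y = 0 := by
  have hK : IsClosed (C.chart i '' tsupport (C.f i)) :=
    ((isClosed_tsupport (C.f i)).isCompact.image_of_continuousOn
      ((C.chart i).continuousOn.mono (C.tsupport_f i))).isClosed
  have hxK : x ∉ C.chart i '' tsupport (C.f i) := by
    rintro ⟨p, hp, rfl⟩
    exact hx ((C.chart i).map_source (C.tsupport_f i hp))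
  filter_upwards [hK.isOpen_compl.mem_nhds hxK] with y hy h
  by_cases hyt : y ∈ (C.chart i).target
  · have : C.f i ((C.chart i).symm y) = 0 := by
      by_contra h0
      exact hy ⟨_, subset_tsupport _ h0, (C.chart i).right_inv hyt⟩
    rw [localExt, indicator_of_mem hyt, this, zero_smul]
  · exact indicator_of_notMem hyt _

variable [IsManifold (𝓡 n) ∞ M]

theorem contMDiff_emb : ContMDiff (𝓡 n) 𝓘(ℝ, Ambient n N) ∞ C.emb := by
  refine contMDiff_pi_space.2 fun i => ContMDiff.prodMk_space ?_ (C.contMDiff_ρ i)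
  refine contMDiff_of_tsupport fun p hp => ?_
  exact (C.contMDiff_f i p).smul (contMDiffAt_of_mem_maximalAtlas
    (IsManifold.chart_mem_maximalAtlas (C.center i))
    (C.tsupport_f i (tsupport_smul_subset_left _ _ hp)))

/-- Charts of `M` factor locally through smooth maps on the ambient space. -/
theorem exists_chart_extension {ψ : OpenPartialHomeomorph M (EuclideanSpace ℝ (Fin n))}
    (hψ : ψ ∈ IsManifold.maximalAtlas (𝓡 n) ∞ M) {p : M} (hp : p ∈ ψ.source) :
    ∃ g : Ambient n N → EuclideanSpace ℝ (Fin n), ContDiffAt ℝ ∞ g (C.emb p) ∧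
      ∀ᶠ q in 𝓝 p, g (C.emb q) = ψ q := by
  obtain ⟨i, hi⟩ := C.exists_ρ_ne_zero p
  have hs := C.mem_source hi
  refine ⟨fun y => ψ ((C.chart i).symm (y i).1), ?_, ?_⟩
  · have h1 : ContDiff ℝ ∞ fun y : Ambient n N => (y i).1 := (contDiff_apply _ _ i).fst
    refine ContDiffAt.comp (g := fun x => ψ ((C.chart i).symm x)) _ ?_ h1.contDiffAt
    rw [C.emb_fst hi]
    refine contDiffAt_comp_symm (IsManifold.chart_mem_maximalAtlas (C.center i))
      ((C.chart i).map_source hs) ?_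
    rw [(C.chart i).left_inv hs]
    exact contMDiffAt_of_mem_maximalAtlas hψ hp
  · filter_upwards [((C.contMDiff_ρ i).continuous.tendsto p).eventually_ne hi] with q hq
    rw [C.emb_fst hq, (C.chart i).left_inv (C.mem_source hq)]

variable [CompactSpace M]

theorem contDiff_localExt (i : Fin N) {h : M → F} (hh : ContMDiff (𝓡 n) 𝓘(ℝ, F) ∞ h) :
    ContDiff ℝ ∞ (C.localExt i h) := by
  refine contDiff_iff_contDiffAt.2 fun x => ?_
  by_cases hx : x ∈ (C.chart i).target
  · refine ContDiffAt.congr_of_eventuallyEq ?_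
      ((C.localExt_eventuallyEq hx).mono fun y hy => hy h)
    have hφ := IsManifold.chart_mem_maximalAtlas (I := 𝓡 n) (n := ∞) (C.center i)
    exact (contDiffAt_comp_symm hφ hx (C.contMDiff_f i _)).smul (contDiffAt_comp_symm hφ hx (hh _))
  · exact contDiffAt_const.congr_of_eventuallyEq
      ((C.localExt_eventuallyEq_zero hx).mono fun y hy => hy h)

theorem contDiff_ext {β : Ambient n N → ℝ} (hβ : ContDiff ℝ ∞ β) {h : M → F}
    (hh : ContMDiff (𝓡 n) 𝓘(ℝ, F) ∞ h) : ContDiff ℝ ∞ (C.ext β h) := by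
  refine hβ.smul (ContDiff.sum fun i _ => ?_)
  have h1 : ContDiff ℝ ∞ fun y : Ambient n N => y i := contDiff_apply _ _ i
  exact h1.snd.smul ((C.contDiff_localExt i hh).comp h1.fst)

theorem isClosedEmbedding_emb : IsClosedEmbedding C.emb :=
  C.contMDiff_emb.continuous.isClosedEmbedding C.emb_injective

end

/-- The extension uses only fixed smooth multipliers and substitutions, so convergence in charts
carries over to the ambient space. -/
theorem smoothConv_ext [CompactSpace M] [IsManifold (𝓡 n) ∞ M] {F : Type} [NormedAddCommGroup F]
    [NormedSpace ℝ F] {ι : Type*} {l : Filter ι} {r : ℕ} {β : Ambient n N → ℝ}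
    (hβ : ContDiff ℝ ∞ β) {h : ι → M → F} {w : M → F}
    (H : ∀ i, ∀ x ∈ (C.chart i).target, SmoothConv l r
      (fun m y => h m ((C.chart i).symm y)) (fun y => w ((C.chart i).symm y)) x)
    (y : Ambient n N) : SmoothConv l r (fun m => C.ext β (h m)) (C.ext β w) y := by
  have hle : (r : WithTop ℕ∞) ≤ ∞ := by exact_mod_cast le_top
  have key : ∀ i x, SmoothConv l r (fun m => C.localExt i (h m)) (C.localExt i w) x := by
    intro i x
    by_cases hx : x ∈ (C.chart i).target
    · have hφ := IsManifold.chart_mem_maximalAtlas (I := 𝓡 n) (n := ∞) (C.center i)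
      have h1 := SmoothConv.const (l := l)
        ((contDiffAt_comp_symm hφ hx (C.contMDiff_f i _)).of_le hle)
      refine (h1.smul (H i x hx)).congr ?_ ?_
      · exact tendsto_snd.eventually ((C.localExt_eventuallyEq hx).mono fun y hy m => hy (h m))
          |>.mono fun q hq => (hq q.1).symm
      · exact (C.localExt_eventuallyEq hx).mono fun y hy => (hy w).symm
    · refine (SmoothConv.const (contDiffAt_const (c := (0 : F)))).congr ?_ ?_
      · exact tendsto_snd.eventually ((C.localExt_eventuallyEq_zero hx).mono fun y hy m => hy (h m))
          |>.mono fun q hq => (hq q.1).symm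
      · exact (C.localExt_eventuallyEq_zero hx).mono fun y hy => (hy w).symm
  have hi : ∀ i, ContDiff ℝ ∞ fun y : Ambient n N => y i := fun i => contDiff_apply _ _ i
  refine (SmoothConv.const (hβ.contDiffAt.of_le hle)).smul (SmoothConv.sum _ fun i _ => ?_)
  exact (SmoothConv.const ((hi i).snd.contDiffAt.of_le hle)).smul
    ((key i _).comp_right ((hi i).fst.contDiffAt.of_le hle))

end ChartCutoffs

end DiffTangent

/-! ### The flow of a vector field on `M` -/

namespace DiffTangent

variable {n : ℕ} {M : Type*} [TopologicalSpace M] [ChartedSpace (EuclideanSpace ℝ (Fin n)) M]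
  [IsManifold (𝓡 n) ∞ M]

theorem VectorFields.contMDiff_one (X : VectorFields n M) :
    ContMDiff (𝓡 n) (𝓡 n).tangent 1 (fun x => (⟨x, X x⟩ : TangentBundle (𝓡 n) M)) :=
  X.contMDiff.of_le (by simp)

namespace ChartCutoffs

variable {N : ℕ} (C : ChartCutoffs n M N)

/-- The vector field `X` read in the ambient space: `p ↦ d(emb)_p (X p)`. -/
noncomputable def push (X : VectorFields n M) (p : M) : Ambient n N :=
  mfderiv (𝓡 n) 𝓘(ℝ, Ambient n N) C.emb p (X p)

theorem contMDiff_push (X : VectorFields n M) :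
    ContMDiff (𝓡 n) 𝓘(ℝ, Ambient n N) ∞ (C.push X) := by
  have h1 := C.contMDiff_emb.contMDiff_tangentMap (m := ∞) (by simp)
  have h2 := h1.comp X.contMDiff
  exact (contMDiff_snd_tangentBundle_modelSpace (Ambient n N) 𝓘(ℝ, Ambient n N)).comp h2

theorem hasDerivAt_emb_comp {X : VectorFields n M} {γ : ℝ → M} {t : ℝ}
    (h : HasMFDerivAt 𝓘(ℝ, ℝ) (𝓡 n) γ t ((1 : ℝ →L[ℝ] ℝ).smulRight (X (γ t)))) :
    HasDerivAt (fun s => C.emb (γ s)) (C.push X (γ t)) t := by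
  have h1 := (C.contMDiff_emb.mdifferentiable (by simp) (γ t)).hasMFDerivAt.comp t h
  have aux : ∀ {g : ℝ → Ambient n N} (L : EuclideanSpace ℝ (Fin n) →L[ℝ] Ambient n N)
      (v : EuclideanSpace ℝ (Fin n)),
      HasFDerivAt g (L.comp ((1 : ℝ →L[ℝ] ℝ).smulRight v)) t → HasDerivAt g (L v) t :=
    fun L v hg => by simpa using hg.hasDerivAt
  exact aux _ _ (hasMFDerivAt_iff_hasFDerivAt.1 h1)

theorem exists_cutoff [CompactSpace M] : ∃ β : Ambient n N → ℝ, ContDiff ℝ ∞ β ∧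
    HasCompactSupport β ∧ ∀ p, β (C.emb p) = 1 := by
  obtain ⟨R, hR, h⟩ :=
      (isCompact_range C.contMDiff_emb.continuous).isBounded.subset_closedBall_lt 0 0
  let β : ContDiffBump (0 : Ambient n N) := ⟨R, R + 1, hR, by linarith⟩
  exact ⟨β, β.contDiff, β.hasCompactSupport, fun p => β.one_of_mem_closedBall
      (h (mem_range_self p))⟩

/-- Integral curves of `X` are mapped to integral curves of any extension of `X`. -/
theorem emb_eq_of_isMIntegralCurve {X : VectorFields n M} {Y : Ambient n N → Ambient n N}
    (hY : ContDiff ℝ ∞ Y) (hYc : HasCompactSupport Y) (hYe : ∀ q, Y (C.emb q) = C.push X q)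
    {Φ : ℝ → Ambient n N → Ambient n N} (hΦ : IsUnitFlow Y Φ) {γ : ℝ → M}
    (hγ : IsMIntegralCurve γ (fun q => X q)) : C.emb (γ 1) = Φ 1 (C.emb (γ 0)) := by
  obtain ⟨K, hK⟩ := hY.lipschitzWith_of_hasCompactSupport hYc (by simp)
  have h1 : ∀ t, HasDerivAt (fun s => C.emb (γ s)) (Y (C.emb (γ t))) t := fun t => by
    rw [hYe]
    exact C.hasDerivAt_emb_comp (hγ t)
  have h2 := (hΦ (C.emb (γ 0))).2
  refine ODE_solution_unique_of_mem_Icc_right (v := fun _ => Y) (s := fun _ => univ) (K := K)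
    (a := 0) (b := 1) (f := fun s => C.emb (γ s)) (g := fun s => Φ s (C.emb (γ 0)))
    (fun _ _ => hK.lipschitzOnWith)
    (fun t _ => (h1 t).continuousAt.continuousWithinAt) (fun t _ => (h1 t).hasDerivWithinAt)
    (fun _ _ => mem_univ _) (fun t ht => (h2 t ht).continuousWithinAt)
    (fun t ht => (h2 t (Ico_subset_Icc_self ht)).mono_of_mem_nhdsWithin
        (Icc_mem_nhdsGE_of_mem ht)) (fun _ _ => mem_univ _) ?_ (by simp)
  exact (hΦ _).1.symm

/-- A self-map of `M` that is induced by a smooth map of the ambient space is smooth. -/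
theorem contMDiff_of_emb_comp [CompactSpace M] {f : M → M} {Ψ : Ambient n N → Ambient n N}
    (hΨ : ContDiff ℝ ∞ Ψ)
    (h : ∀ p, C.emb (f p) = Ψ (C.emb p)) : ContMDiff (𝓡 n) (𝓡 n) ∞ f := by
  have hc : Continuous f := by
    rw [C.isClosedEmbedding_emb.isInducing.continuous_iff]
    exact (hΨ.continuous.comp C.contMDiff_emb.continuous).congr fun p => (h p).symm
  intro p
  have hψ := IsManifold.chart_mem_maximalAtlas (I := 𝓡 n) (n := ∞) (f p)
  have hp := mem_chart_source (EuclideanSpace ℝ (Fin n)) (f p)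
  obtain ⟨g, hg, hge⟩ := C.exists_chart_extension hψ hp
  have h1 : ContMDiffAt (𝓡 n) (𝓡 n) ∞ (fun q => g (Ψ (C.emb q))) p := by
    have h2 : ContDiffAt ℝ ∞ (fun y => g (Ψ y)) (C.emb p) := by
      refine ContDiffAt.comp (g := g) (C.emb p) ?_ hΨ.contDiffAt
      rwa [← h]
    exact h2.contMDiffAt.comp p (C.contMDiff_emb p)
  have h0 : g (Ψ (C.emb p)) = chartAt (EuclideanSpace ℝ (Fin n)) (f p) (f p) := by
    rw [← h]; exact hge.self_of_nhds
  have h2 : ContMDiffAt (𝓡 n) (𝓡 n) ∞ (chartAt (EuclideanSpace ℝ (Fin n)) (f p)).symm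
      (g (Ψ (C.emb p))) := by
    rw [h0]
    exact contMDiffAt_symm_of_mem_maximalAtlas hψ (mem_chart_target _ _)
  refine (h2.comp p h1).congr_of_eventuallyEq ?_
  filter_upwards [hc.continuousAt.eventually hge, hc.continuousAt.eventually
    ((chartAt (EuclideanSpace ℝ (Fin n)) (f p)).open_source.mem_nhds hp)] with q hq hq'
  simp only [Function.comp]
  rw [← h, hq, OpenPartialHomeomorph.left_inv _ hq']

end ChartCutoffs

variable [CompactSpace M] [T2Space M]

/-- Compactness of `M` bounds the existence time of integral curves from below. -/
theorem exists_isMIntegralCurve (X : VectorFields n M) (p : M) :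
    ∃ γ : ℝ → M, γ 0 = p ∧ IsMIntegralCurve γ (fun q => X q) := by
  obtain ⟨N, ⟨C⟩⟩ := exists_chartCutoffs n M
  obtain ⟨β, hβ, hβc, hβ1⟩ := C.exists_cutoff
  set Y := C.ext β (C.push X)
  have hY : ContDiff ℝ ∞ Y := C.contDiff_ext hβ (C.contMDiff_push X)
  have hYc : HasCompactSupport Y := C.hasCompactSupport_ext hβc _
  have hYe : ∀ q, Y (C.emb q) = C.push X q := fun q => C.ext_emb (hβ1 q) _
  obtain ⟨K, hK⟩ := hY.lipschitzWith_of_hasCompactSupport hYc (by simp)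
  obtain ⟨D, hD⟩ := hYc.exists_bound_of_continuous hY.continuous
  have : IsManifold (𝓡 n) 1 M := IsManifold.of_le (n := ∞) (by simp)
  refine exists_isMIntegralCurve_of_isMIntegralCurveOn X.contMDiff_one one_pos (fun p => ?_) p
  -- The ambient field is bounded and globally Lipschitz, so the existence time `1` serves all
  -- points. It remains to see that the ambient curve stays in `M`.
  have hPL : IsPicardLindelof (fun _ => Y) (tmin := -1) (tmax := 1) ⟨0, by simp⟩ (C.emb p)
      D.toNNReal 0 D.toNNReal K :=
    { lipschitzOnWith := fun t _ => hK.lipschitzOnWith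
      continuousOn := fun x _ => continuousOn_const
      norm_le := fun t _ x _ => (hD x).trans (Real.le_coe_toNNReal D)
      mul_max_le := by simp }
  obtain ⟨z, hz0, hz⟩ := hPL.exists_eq_forall_mem_Icc_hasDerivWithinAt₀
  have hz' : ∀ t ∈ Ioo (-1 : ℝ) 1, HasDerivAt z (Y (z t)) t := fun t ht =>
    (hz t (Ioo_subset_Icc_self ht)).hasDerivAt (Icc_mem_nhds ht.1 ht.2)
  have hloc : ∀ t ∈ Ioo (-1 : ℝ) 1, ∀ q, z t = C.emb q → ∃ γ : ℝ → M, γ t = q ∧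
      IsMIntegralCurveAt γ (fun q => X q) t ∧ ∀ᶠ s in 𝓝 t, z s = C.emb (γ s) := by
    intro t ht q hq
    obtain ⟨γ, hγ, hγX⟩ := exists_isMIntegralCurveAt_of_contMDiffAt_boundaryless t
      (X.contMDiff_one q)
    refine ⟨γ, hγ, hγX, ?_⟩
    refine ODE_solution_unique_of_eventually (v := fun _ => Y) (s := fun _ => univ) (K := K)
      (Eventually.of_forall fun _ => hK.lipschitzOnWith) ?_ ?_ (by rw [hq, hγ])
    · filter_upwards [Ioo_mem_nhds ht.1 ht.2] with s hs using ⟨hz' s hs, mem_univ _⟩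
    · filter_upwards [hγX] with s hs
      rw [hYe]
      exact ⟨C.hasDerivAt_emb_comp hs, mem_univ _⟩
  -- The times spent in `M` form an open set, by local solvability in `M` and uniqueness, and a
  -- relatively closed one, since the image of `M` is closed.
  have hrange : Ioo (-1 : ℝ) 1 ⊆ {t | t ∈ Ioo (-1 : ℝ) 1 ∧ z t ∈ range C.emb} := by
    refine isPreconnected_Ioo.subset_of_closure_inter_subset ?_ ?_ ?_
    · refine isOpen_iff_mem_nhds.2 fun t ht => ?_
      obtain ⟨q, hq⟩ := ht.2
      obtain ⟨γ, -, -, hγ⟩ := hloc t ht.1 q hq.symm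
      filter_upwards [hγ, Ioo_mem_nhds ht.1.1 ht.1.2] with s hs hs'
      exact ⟨hs', γ s, hs.symm⟩
    · exact ⟨0, by simp, by simp, p, hz0.symm⟩
    · rintro t ⟨htc, ht⟩
      refine ⟨ht, ?_⟩
      rw [← C.isClosedEmbedding_emb.isClosed_range.closure_eq]
      exact ((hz' t ht).continuousAt.continuousWithinAt).mem_closure htc fun s hs => hs.2
  have : Nonempty M := ⟨p⟩
  choose! γ hγ using fun t (ht : t ∈ Ioo (-1 : ℝ) 1) => (hrange ht).2
  refine ⟨γ, C.emb_injective ((hγ 0 (by simp)).trans hz0), fun t ht => ?_⟩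
  obtain ⟨δ, hδt, hδ, hδz⟩ := hloc t ht (γ t) (hγ t ht).symm
  have heq : γ =ᶠ[𝓝 t] δ := by
    filter_upwards [hδz, Ioo_mem_nhds ht.1 ht.2] with s hs hs'
    exact C.emb_injective ((hγ s hs').trans hs)
  have := hδ.hasMFDerivAt
  rw [hδt] at this
  exact (this.congr_of_eventuallyEq heq).hasMFDerivWithinAt

theorem contMDiff_timeOne (X : VectorFields n M) {γ : M → ℝ → M} (h0 : ∀ p, γ p 0 = p)
    (hγ : ∀ p, IsMIntegralCurve (γ p) (fun q => X q)) :
    ContMDiff (𝓡 n) (𝓡 n) ∞ (fun p => γ p 1) := by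
  obtain ⟨N, ⟨C⟩⟩ := exists_chartCutoffs n M
  obtain ⟨β, hβ, hβc, hβ1⟩ := C.exists_cutoff
  have hY := C.contDiff_ext hβ (C.contMDiff_push X)
  have hYc := C.hasCompactSupport_ext hβc (C.push X)
  obtain ⟨Φ, hΦ⟩ := exists_isUnitFlow hY hYc
  refine C.contMDiff_of_emb_comp (hΦ.contDiff hY) fun p => ?_
  have := C.emb_eq_of_isMIntegralCurve hY hYc (fun q => C.ext_emb (hβ1 q) _) hΦ (hγ p)
  rwa [h0] at this

/-- The inverse is the time `-1` map, by the flow law; it is smooth as the time-one map of `-X`. -/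
theorem exists_isTimeOneMap (X : VectorFields n M) : ∃ f : Diff n M, IsTimeOneMap X f := by
  obtain ⟨N, ⟨C⟩⟩ := exists_chartCutoffs n M
  have : IsManifold (𝓡 n) 1 M := IsManifold.of_le (n := ∞) (by simp)
  choose γ h0 hγ using exists_isMIntegralCurve X
  have hneg : ∀ p, IsMIntegralCurve (fun t => γ p (-t)) (fun q => (-X) q) := fun p => by
    have := (hγ p).comp_mul (-1)
    convert! this using 1
    · ext t; simp
    · ext1 q; simp
  have huniq : ∀ p s t, γ (γ p s) t = γ p (t + s) := fun p s t =>
    congrFun (isMIntegralCurve_Ioo_eq_of_contMDiff_boundaryless (t₀ := 0) X.contMDiff_one (hγ _)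
      ((hγ p).comp_add s) (by simp [h0])) t
  exact ⟨{
    toFun := fun p => γ p 1
    invFun := fun p => γ p (-1)
    left_inv := fun p => by simp [huniq, h0]
    right_inv := fun p => by simp [huniq, h0]
    contMDiff_toFun := contMDiff_timeOne X h0 hγ
    contMDiff_invFun := contMDiff_timeOne (γ := fun p t => γ p (-t)) (-X) (by simp [h0]) hneg },
    fun p => ⟨γ p, h0 p, hγ p, rfl⟩⟩

theorem isTimeOneMap_exp (X : VectorFields n M) : IsTimeOneMap X (exp X) := by
  rw [exp, dif_pos (exists_isTimeOneMap X)]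
  exact (exists_isTimeOneMap X).choose_spec

end DiffTangent

/-! ### Convergence of diffeomorphisms and the sequential closure -/

namespace DiffTangent

theorem tendsto_prod_symm {M ι : Type*} [TopologicalSpace M] {n : ℕ} (l : Filter ι)
    {φ : OpenPartialHomeomorph M (EuclideanSpace ℝ (Fin n))} {p : M} (hp : p ∈ φ.source) :
    Tendsto (fun q : ι × EuclideanSpace ℝ (Fin n) => (q.1, φ.symm q.2)) (l ×ˢ 𝓝 (φ p))
      (l ×ˢ 𝓝 p) := by
  have h := (φ.continuousAt_symm (φ.map_source hp)).tendsto
  rw [φ.left_inv hp] at h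
  exact tendsto_fst.prodMk (h.comp tendsto_snd)

variable {n : ℕ} {M : Type*} [TopologicalSpace M] [ChartedSpace (EuclideanSpace ℝ (Fin n)) M]

/-- Sequential form of convergence in the `C^∞` topology: continuous convergence of the maps and,
in all charts, of all derivatives. -/
structure DiffConv {ι : Type*} (l : Filter ι) (g : ι → Diff n M) (g₀ : Diff n M) : Prop where
  tendsto : ∀ p, Tendsto (fun q : ι × M => g q.1 q.2) (l ×ˢ 𝓝 p) (𝓝 (g₀ p))
  smoothConv : ∀ φ ∈ IsManifold.maximalAtlas (𝓡 n) ∞ M, ∀ ψ ∈ IsManifold.maximalAtlas (𝓡 n) ∞ M,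
    ∀ p ∈ φ.source, g₀ p ∈ ψ.source → ∀ r : ℕ,
      SmoothConv l r (fun i => localRep φ ψ (g i)) (localRep φ ψ g₀) (φ p)

/-- By compactness the preimages converge along any ultrafilter to some `p`, and continuous
convergence of `g` forces `g₀ p = q`. -/
theorem DiffConv.tendsto_inv [CompactSpace M] [T2Space M] {ι : Type*}
    {l : Filter ι} {g : ι → Diff n M} {g₀ : Diff n M}
    (hg : DiffConv l g g₀) (q : M) :
    Tendsto (fun z : ι × M => (g z.1)⁻¹ z.2) (l ×ˢ 𝓝 q) (𝓝 (g₀⁻¹ q)) := by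
  refine tendsto_iff_ultrafilter _ _ _ |>.2 fun U hU => ?_
  obtain ⟨p, -, hp⟩ := isCompact_univ.ultrafilter_le_nhds
    (U.map fun z : ι × M => (g z.1)⁻¹ z.2) (by simp)
  have h1 : Tendsto (fun z : ι × M => (z.1, (g z.1)⁻¹ z.2)) U (l ×ˢ 𝓝 p) :=
    (tendsto_fst.mono_left hU).prodMk hp
  have h2 := (hg.tendsto p).comp h1
  have h3 : Tendsto (fun z : ι × M => z.2) U (𝓝 q) := tendsto_snd.mono_left hU
  have h4 : g₀ p = q := by
    refine tendsto_nhds_unique h2 (h3.congr fun z => ?_)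
    exact ((g z.1).apply_symm_apply z.2).symm
  have h5 : g₀⁻¹ q = p := by rw [← h4]; exact g₀.symm_apply_apply p
  rw [h5]
  exact hp

variable [IsManifold (𝓡 n) ∞ M]

theorem contDiffAt_localRep {φ ψ : OpenPartialHomeomorph M (EuclideanSpace ℝ (Fin n))}
    (hφ : φ ∈ IsManifold.maximalAtlas (𝓡 n) ∞ M) (hψ : ψ ∈ IsManifold.maximalAtlas (𝓡 n) ∞ M)
    (g : Diff n M) {x : EuclideanSpace ℝ (Fin n)} (hx : x ∈ φ.target)
    (hgx : g (φ.symm x) ∈ ψ.source) : ContDiffAt ℝ ∞ (localRep φ ψ g) x :=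
  contDiffAt_comp_symm hφ hx (h := fun p => ψ (g p))
    ((contMDiffAt_of_mem_maximalAtlas hψ hgx).comp _ (g.contMDiff _))

namespace DiffConv

variable {ι : Type*} {l : Filter ι}

theorem const (g : Diff n M) : DiffConv l (fun _ => g) g where
  tendsto p := (g.contMDiff.continuous.tendsto p).comp tendsto_snd
  smoothConv φ hφ ψ hψ p hp hgp r := SmoothConv.const
    ((contDiffAt_localRep hφ hψ g (φ.map_source hp) (by rwa [φ.left_inv hp])).of_le
      (by exact_mod_cast le_top))

theorem mul {f g : ι → Diff n M} {f₀ g₀ : Diff n M} (hf : DiffConv l f f₀) (hg : DiffConv l g g₀) :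
    DiffConv l (fun i => f i * g i) (f₀ * g₀) where
  tendsto p := (hf.tendsto (g₀ p)).comp (tendsto_fst.prodMk (hg.tendsto p))
  smoothConv φ hφ ψ hψ p hp hgp r := by
    let χ := chartAt (EuclideanSpace ℝ (Fin n)) (g₀ p)
    have hχ : χ ∈ IsManifold.maximalAtlas (𝓡 n) ∞ M := IsManifold.chart_mem_maximalAtlas _
    have hpχ : g₀ p ∈ χ.source := mem_chart_source _ _
    have h1 := hg.smoothConv φ hφ χ hχ p hp hpχ r
    have h2 := hf.smoothConv χ hχ ψ hψ (g₀ p) hpχ hgp r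
    have e : localRep φ χ g₀ (φ p) = χ (g₀ p) := by simp [localRep, φ.left_inv hp]
    rw [← e] at h2
    refine (h2.comp h1).congr ?_ ?_
    · filter_upwards [((hg.tendsto p).comp (tendsto_prod_symm l hp)).eventually
        (χ.open_source.mem_nhds hpχ)] with q hq
      exact congrArg (fun z => ψ (f q.1 z)) (χ.left_inv hq)
    · have h := (φ.continuousAt_symm (φ.map_source hp)).tendsto
      rw [φ.left_inv hp] at h
      filter_upwards [((g₀.contMDiff.continuous.tendsto p).comp h).eventually
        (χ.open_source.mem_nhds hpχ)] with y hy
      exact congrArg (fun z => ψ (f₀ z)) (χ.left_inv hy)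

theorem inv [CompactSpace M] [T2Space M] {g : ι → Diff n M} {g₀ : Diff n M}
    (hg : DiffConv l g g₀) : DiffConv l (fun i => (g i)⁻¹) g₀⁻¹ where
  tendsto := hg.tendsto_inv
  smoothConv φ hφ ψ hψ q hq hgq r := by
    set p := g₀⁻¹ q with hp
    have hgp : g₀ p = q := g₀.apply_symm_apply q
    have hinv : ∀ (f : Diff n M) z, f (f⁻¹ z) = z := fun f z => f.apply_symm_apply z
    have hinv' : ∀ (f : Diff n M) z, f⁻¹ (f z) = z := fun f z => f.symm_apply_apply z
    have hφt := φ.open_target.mem_nhds (φ.map_source hq)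
    have hψt := ψ.open_target.mem_nhds (ψ.map_source hgq)
    have e : localRep φ ψ g₀⁻¹ (φ q) = ψ p := by simp only [localRep, φ.left_inv hq, ← hp]
    have h1 := hg.smoothConv ψ hψ φ hφ p hgq (by rwa [hgp]) r
    have ev1 : ∀ᶠ z in l ×ˢ 𝓝 (φ q), z.2 ∈ φ.target ∧ (g z.1)⁻¹ (φ.symm z.2) ∈ ψ.source :=
      (tendsto_snd.eventually hφt).and (((hg.tendsto_inv q).comp
          (tendsto_prod_symm l hq)).eventually
        (ψ.open_source.mem_nhds hgq))
    have ev2 : ∀ᶠ z in l ×ˢ 𝓝 (ψ p), z.2 ∈ ψ.target ∧ g z.1 (ψ.symm z.2) ∈ φ.source :=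
      (tendsto_snd.eventually hψt).and (((hg.tendsto p).comp (tendsto_prod_symm l hgq)).eventually
        (φ.open_source.mem_nhds (by rwa [hgp])))
    have ev3 : ∀ᶠ y in 𝓝 (φ q), y ∈ φ.target ∧ g₀⁻¹ (φ.symm y) ∈ ψ.source := by
      have h := (φ.continuousAt_symm (φ.map_source hq)).tendsto
      rw [φ.left_inv hq] at h
      exact (show ∀ᶠ y in 𝓝 (φ q), y ∈ φ.target from hφt).and
        ((((g₀⁻¹).contMDiff.continuous.tendsto q).comp h).eventually (ψ.open_source.mem_nhds hgq))
    have ev4 : ∀ᶠ y in 𝓝 (ψ p), y ∈ ψ.target ∧ g₀ (ψ.symm y) ∈ φ.source := by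
      have h := (ψ.continuousAt_symm (ψ.map_source hgq)).tendsto
      rw [ψ.left_inv hgq] at h
      exact (show ∀ᶠ y in 𝓝 (ψ p), y ∈ ψ.target from hψt).and
        (((g₀.contMDiff.continuous.tendsto p).comp h).eventually
          (φ.open_source.mem_nhds (by rwa [hgp])))
    have hl : ∀ (f : Diff n M) (y : EuclideanSpace ℝ (Fin n)),
        y ∈ φ.target ∧ f⁻¹ (φ.symm y) ∈ ψ.source → localRep ψ φ f (localRep φ ψ f⁻¹ y) = y := by
      rintro f y ⟨hy, hy'⟩
      simp only [localRep]
      rw [ψ.left_inv hy', hinv, φ.right_inv hy]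
    have hr : ∀ (f : Diff n M) (y : EuclideanSpace ℝ (Fin n)),
        y ∈ ψ.target ∧ f (ψ.symm y) ∈ φ.source → localRep φ ψ f⁻¹ (localRep ψ φ f y) = y := by
      rintro f y ⟨hy, hy'⟩
      simp only [localRep]
      rw [φ.left_inv hy', hinv', ψ.right_inv hy]
    have hd : ∀ (f : Diff n M) (y : EuclideanSpace ℝ (Fin n)),
        y ∈ φ.target ∧ f⁻¹ (φ.symm y) ∈ ψ.source →
          DifferentiableAt ℝ (localRep φ ψ f⁻¹) y := fun f y hy =>
      (contDiffAt_localRep hφ hψ f⁻¹ hy.1 hy.2).differentiableAt (by simp)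
    rw [← e] at h1 ev2 ev4
    refine SmoothConv.of_inverse h1 ?_ (ev1.mono fun z hz => hd _ _ hz)
        (ev3.mono fun y hy => hd _ _ hy)
      (ev1.mono fun z hz => hl _ _ hz) (ev2.mono fun z hz => hr _ _ hz)
      (ev3.mono fun y hy => hl _ _ hy) (ev4.mono fun y hy => hr _ _ hy)
    rw [e]
    exact (ψ.continuousAt hgq).tendsto.comp
      ((hg.tendsto_inv q).comp (tendsto_prod_symm l hq))

theorem tendsto_smoothTopology {g : ι → Diff n M} {g₀ : Diff n M} (hg : DiffConv l g g₀) :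
    Tendsto g l (@nhds _ (smoothTopology n M) g₀) := by
  refine TopologicalSpace.tendsto_nhds_generateFrom_iff.2 ?_
  rintro _ ⟨f, φ, ψ, K, r, ε, hφ, hψ, hK, hKφ, hfK, hε, rfl⟩ ⟨hmap, hlt⟩
  have key : ∀ᶠ i in l, ∀ p ∈ K, g i p ∈ ψ.source ∧ ∀ j ∈ Iic r,
      ‖iteratedFDeriv ℝ j (localRep φ ψ (g i)) (φ p) -
        iteratedFDeriv ℝ j (localRep φ ψ f) (φ p)‖ < ε := by
    refine hK.eventually_forall_of_prod fun p hp => ?_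
    have hφp : Tendsto (fun z : ι × M => (z.1, φ z.2)) (l ×ˢ 𝓝 p) (l ×ˢ 𝓝 (φ p)) :=
      tendsto_fst.prodMk ((φ.continuousAt (hKφ hp)).tendsto.comp tendsto_snd)
    refine ((hg.tendsto p).eventually (ψ.open_source.mem_nhds (hmap hp))).and
      ((eventually_all_finite (finite_Iic r)).2 fun j hj => ?_)
    have h1 := (hg.smoothConv φ hφ ψ hψ p (hKφ hp) (hmap hp) r).tendsto_iteratedFDeriv hj
    -- The subbasic set is centred at `f`, not at `g₀`, so `f` enters as a constant family; the
    -- strict inequality for `g₀` at `p` persists nearby.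
    have h2 := ((const (l := l) f).smoothConv φ hφ ψ hψ p (hKφ hp)
      (hfK hp) r).tendsto_iteratedFDeriv hj
    exact (((h1.sub h2).norm).comp hφp).eventually (gt_mem_nhds (hlt j hj p hp))
  filter_upwards [key] with i hi
  exact ⟨fun p hp => (hi p hp).1, fun j hj p hp => (hi p hp).2 j hj⟩

end DiffConv

/-- Limits of sequences in a subgroup form a subgroup. -/
def seqClosure [CompactSpace M] [T2Space M] (G : Subgroup (Diff n M)) : Subgroup (Diff n M) where
  carrier := {g | ∃ f : ℕ → Diff n M, (∀ᶠ m in atTop, f m ∈ G) ∧ DiffConv atTop f g}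
  one_mem' := ⟨fun _ => 1, Eventually.of_forall fun _ => G.one_mem, DiffConv.const 1⟩
  mul_mem' := by
    rintro a b ⟨f, hf, hfa⟩ ⟨g, hg, hgb⟩
    exact ⟨_, (hf.and hg).mono fun m hm => G.mul_mem hm.1 hm.2, hfa.mul hgb⟩
  inv_mem' := by
    rintro a ⟨f, hf, hfa⟩
    exact ⟨_, hf.mono fun m hm => G.inv_mem hm, hfa.inv⟩

theorem seqClosure_subset_closure [CompactSpace M] [T2Space M] (G : Subgroup (Diff n M)) :
    (seqClosure G : Set (Diff n M)) ⊆ closure[smoothTopology n M] (G : Set (Diff n M)) := by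
  rintro g ⟨f, hf, hfg⟩
  let _ := smoothTopology n M
  exact mem_closure_of_tendsto hfg.tendsto_smoothTopology hf

end DiffTangent

/-! ### Approximation of `exp X` by powers of elements of `G` -/

namespace DiffTangent

variable {n : ℕ} {M : Type*} [TopologicalSpace M] [ChartedSpace (EuclideanSpace ℝ (Fin n)) M]

theorem pow_apply (g : Diff n M) (m : ℕ) (p : M) : (g ^ m) p = g^[m] p := by
  induction m generalizing p with
  | zero => rfl
  | succ m ih => rw [pow_succ, mul_apply, ih, Function.iterate_succ_apply]

/-- Step sizes `τ m` with `(τ m) ^ k = a / m`. -/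
theorem exists_step_sizes {k : ℕ} (hk : 1 ≤ k) {a : ℝ} (ha : 0 < a) :
    ∃ τ : ℕ → ℝ, Tendsto τ atTop (𝓝[>] 0) ∧ ∀ m : ℕ, τ m ^ k = a / m := by
  have hk' : (k : ℝ) ≠ 0 := by positivity
  refine ⟨fun m => (a / m) ^ ((k : ℝ)⁻¹), tendsto_nhdsWithin_iff.2 ⟨?_, ?_⟩, fun m => ?_⟩
  · have h1 : Tendsto (fun m : ℕ => a / (m : ℝ)) atTop (𝓝 0) :=
      tendsto_const_div_atTop_nhds_zero_nat a
    have h2 := h1.rpow_const (p := (k : ℝ)⁻¹) (Or.inr (by positivity))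
    rwa [Real.zero_rpow (inv_ne_zero hk')] at h2
  · filter_upwards [eventually_gt_atTop 0] with m hm
    have : (0 : ℝ) < m := by exact_mod_cast hm
    exact Real.rpow_pos_of_pos (by positivity) _
  · rw [← Real.rpow_natCast, ← Real.rpow_mul (by positivity), inv_mul_cancel₀ hk', Real.rpow_one]

theorem IsSmoothCurveOn.contMDiffAt {φ : ℝ → Diff n M} {I : Set ℝ} (hI : IsOpen I)
    (hφ : IsSmoothCurveOn φ I) {t : ℝ} (ht : t ∈ I) (p : M) :
    ContMDiffAt (𝓘(ℝ, ℝ).prod (𝓡 n)) (𝓡 n) ∞ (fun q : ℝ × M => φ q.1 q.2) (t, p) :=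
  ContMDiffOn.contMDiffAt hφ ((hI.prod isOpen_univ).mem_nhds ⟨ht, mem_univ _⟩)

variable [IsManifold (𝓡 n) ∞ M]

theorem ChartCutoffs.tendsto_push {N : ℕ} (C : ChartCutoffs n M N) {X : VectorFields n M}
    {φ : ℝ → Diff n M} {I : Set ℝ} (hI : IsOpen I) (h0 : 0 ∈ I) (hφ : IsSmoothCurveOn φ I)
    (hφ0 : φ 0 = 1) {k : ℕ} (hk : 1 ≤ k) {p : M}
    (hX : IsIntegralCurveOfOrder k (fun t => φ t p) p (X p)) :
    Tendsto (fun t : ℝ => (t ^ k)⁻¹ • (C.emb (φ t p) - C.emb p)) (𝓝[>] 0)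
      (𝓝 ((k.factorial : ℝ)⁻¹ • C.push X p)) := by
  obtain ⟨-, hj, hkX⟩ := hX
  set χ := chartAt (EuclideanSpace ℝ (Fin n)) p
  have hp : p ∈ χ.source := mem_chart_source _ p
  have hφp : φ 0 p = p := by rw [hφ0]; rfl
  have hcurve : ContMDiffAt 𝓘(ℝ, ℝ) (𝓡 n) ∞ (fun t => φ t p) 0 := by
    have h1 : ContMDiffAt 𝓘(ℝ, ℝ) (𝓘(ℝ, ℝ).prod (𝓡 n)) ∞ (fun t : ℝ => (t, p)) 0 :=
      contMDiffAt_id.prodMk contMDiffAt_const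
    exact (hφ.contMDiffAt hI h0 p).comp (0 : ℝ) h1
  have hc : ContDiffAt ℝ k (fun t => χ (φ t p)) 0 := by
    have h1 : ContMDiffAt (𝓡 n) (𝓡 n) ∞ χ (φ 0 p) := by
      rw [hφp]
      exact contMDiffAt_of_mem_maximalAtlas (IsManifold.chart_mem_maximalAtlas p) hp
    exact (contMDiffAt_iff_contDiffAt.1 (h1.comp (0 : ℝ) hcurve)).of_le (by exact_mod_cast le_top)
  -- The manifold derivative at `p` is the derivative in the preferred chart at `p`, the same chart
  -- that defines the `k`-th order tangent.
  have hg : HasFDerivAt (fun x => C.emb (χ.symm x))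
      (mfderiv (𝓡 n) 𝓘(ℝ, Ambient n N) C.emb p : EuclideanSpace ℝ (Fin n) →L[ℝ] Ambient n N)
      (χ (φ 0 p)) := by
    have h1 := (C.contMDiff_emb.mdifferentiable (by simp) p).hasMFDerivAt.2
    rw [hφp]
    have aux : ∀ {g : EuclideanSpace ℝ (Fin n) → Ambient n N}
        (L : EuclideanSpace ℝ (Fin n) →L[ℝ] Ambient n N) {s : Set (EuclideanSpace ℝ (Fin n))}
        {x : EuclideanSpace ℝ (Fin n)}, s = univ → HasFDerivWithinAt g L s x → HasFDerivAt g L x :=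
      fun L _ _ hs hg => hasFDerivWithinAt_univ.1 (hs ▸ hg)
    exact aux _ (𝓡 n).range_eq_univ h1
  have := hg.tendsto_pow_smul_sub (c := fun t => χ (φ t p)) hk hc hj
  rw [hkX] at this
  refine this.congr' ?_
  have hs : ∀ᶠ t in 𝓝 (0 : ℝ), φ t p ∈ χ.source :=
    hcurve.continuousAt.eventually (χ.open_source.mem_nhds (by simpa [hφp] using hp))
  filter_upwards [hs.filter_mono nhdsWithin_le_nhds] with t ht
  rw [χ.left_inv ht, hφp, χ.left_inv hp]

theorem ChartCutoffs.eventually_contDiffAt_curve {N : ℕ} (C : ChartCutoffs n M N)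
    {φ : ℝ → Diff n M} {I : Set ℝ} (hI : IsOpen I) (h0 : 0 ∈ I) (hφ : IsSmoothCurveOn φ I)
    {χ : OpenPartialHomeomorph M (EuclideanSpace ℝ (Fin n))}
    (hχ : χ ∈ IsManifold.maximalAtlas (𝓡 n) ∞ M) {x : EuclideanSpace ℝ (Fin n)}
    (hx : x ∈ χ.target) :
    ∀ᶠ q in 𝓝 ((0 : ℝ), x), ContDiffAt ℝ ∞ (fun q : ℝ × EuclideanSpace ℝ (Fin n) =>
      C.emb (φ q.1 (χ.symm q.2)) - C.emb (χ.symm q.2)) q := by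
  filter_upwards [(hI.prod χ.open_target).mem_nhds ⟨h0, hx⟩]
  rintro ⟨t, y⟩ ⟨ht, hy⟩
  have hs : ContMDiffAt 𝓘(ℝ, ℝ × EuclideanSpace ℝ (Fin n)) (𝓡 n) ∞
      (fun q : ℝ × EuclideanSpace ℝ (Fin n) => χ.symm q.2) (t, y) :=
    (contMDiffAt_symm_of_mem_maximalAtlas hχ hy).comp (t, y) contDiff_snd.contMDiff.contMDiffAt
  have hf : ContMDiffAt 𝓘(ℝ, ℝ × EuclideanSpace ℝ (Fin n)) 𝓘(ℝ, ℝ) ∞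
      (fun q : ℝ × EuclideanSpace ℝ (Fin n) => q.1) (t, y) :=
    contDiff_fst.contMDiff.contMDiffAt
  have h1 := (hφ.contMDiffAt hI ht (χ.symm y)).comp (t, y) (hf.prodMk hs)
  exact (contMDiffAt_iff_contDiffAt.1 ((C.contMDiff_emb _).comp (t, y) h1)).sub
    (contMDiffAt_iff_contDiffAt.1 ((C.contMDiff_emb _).comp (t, y) hs))

theorem ChartCutoffs.smoothConv_push {N : ℕ} (C : ChartCutoffs n M N) {X : VectorFields n M}
    {φ : ℝ → Diff n M} {I : Set ℝ} (hI : IsOpen I) (h0 : 0 ∈ I) (hφ : IsSmoothCurveOn φ I)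
    (hφ0 : φ 0 = 1) {k : ℕ} (hk : 1 ≤ k)
    (hX : ∀ p, IsIntegralCurveOfOrder k (fun t => φ t p) p (X p)) {τ : ℕ → ℝ}
    (hτ : Tendsto τ atTop (𝓝[>] 0)) (hτk : ∀ m : ℕ, τ m ^ k = (k.factorial : ℝ) / m)
    {χ : OpenPartialHomeomorph M (EuclideanSpace ℝ (Fin n))}
    (hχ : χ ∈ IsManifold.maximalAtlas (𝓡 n) ∞ M) {x : EuclideanSpace ℝ (Fin n)}
    (hx : x ∈ χ.target) (r : ℕ) :
    SmoothConv atTop r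
      (fun (m : ℕ) y => (m : ℝ) • (C.emb (φ (τ m) (χ.symm y)) - C.emb (χ.symm y)))
      (fun y => C.push X (χ.symm y)) x := by
  have hkf : (k.factorial : ℝ) ≠ 0 := by positivity
  have hlim : ∀ᶠ y in 𝓝 x,
      Tendsto (fun t : ℝ => (t ^ k)⁻¹ • (C.emb (φ t (χ.symm y)) - C.emb (χ.symm y))) (𝓝[>] 0)
        (𝓝 ((k.factorial : ℝ)⁻¹ • C.push X (χ.symm y))) :=
    Eventually.of_forall fun y => C.tendsto_push hI h0 hφ hφ0 hk (hX (χ.symm y))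
  have h1 := SmoothConv.of_tendsto_pow_smul
    (W := fun y => (k.factorial : ℝ)⁻¹ • C.push X (χ.symm y))
    (C.eventually_contDiffAt_curve hI h0 hφ hχ hx) hlim hτ r
  have h2 := (SmoothConv.const_tendsto (tendsto_const_nhds (x := (k.factorial : ℝ))) r x).smul h1
  refine h2.congr (Eventually.of_forall fun q => ?_) (Eventually.of_forall fun y => ?_)
  · have h3 : (k.factorial : ℝ) * (τ q.1 ^ k)⁻¹ = q.1 := by
      rw [hτk, inv_div, mul_div_cancel₀ _ hkf]
    exact (smul_smul _ _ _).trans (congrArg (· • _) h3)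
  · exact smul_inv_smul₀ hkf (C.push X (χ.symm y))

variable [CompactSpace M] [T2Space M]

/-- `exp X` is a limit of the powers `(φ (τ m)) ^ m`, `τ m = (k! / m) ^ (1 / k)`. -/
theorem exp_mem_seqClosure {G : Subgroup (Diff n M)} {X : VectorFields n M}
    (hX : X ∈ tangentAlgebra G) : exp X ∈ seqClosure G := by
  obtain ⟨I, φ, hI, -, h0, hφ, hφG, hφ0, k, hk, hint⟩ := hX
  obtain ⟨N, ⟨C⟩⟩ := exists_chartCutoffs n M
  obtain ⟨β, hβ, hβc, hβ1⟩ := C.exists_cutoff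
  obtain ⟨τ, hτ, hτk⟩ := exists_step_sizes hk (a := (k.factorial : ℝ)) (by positivity)
  set Y := C.ext β (C.push X)
  have hY : ContDiff ℝ ∞ Y := C.contDiff_ext hβ (C.contMDiff_push X)
  have hYc : HasCompactSupport Y := C.hasCompactSupport_ext hβc _
  obtain ⟨Φ, hΦ⟩ := exists_isUnitFlow hY hYc
  have hexp : ∀ p, C.emb (exp X p) = Φ 1 (C.emb p) := fun p => by
    obtain ⟨γ, hγ0, hγ, hγ1⟩ := isTimeOneMap_exp X p
    have := C.emb_eq_of_isMIntegralCurve hY hYc (fun q => C.ext_emb (hβ1 q) _) hΦ hγ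
    rwa [hγ0, ← hγ1] at this
  let h : ℕ → M → Ambient n N := fun m p => (m : ℝ) • (C.emb (φ (τ m) p) - C.emb p)
  -- The rescaled displacement is extended rather than `φ (τ m)` itself. For `m > 0` the map `F m`
  -- restricts to `φ (τ m)` on `M`, and its step quotient is the extension of `h m`.
  let F : ℕ → Ambient n N → Ambient n N := fun m y => y + (m : ℝ)⁻¹ • C.ext β (h m) y
  have hh : ∀ m, ContMDiff (𝓡 n) 𝓘(ℝ, Ambient n N) ∞ (h m) := fun m =>
    (contDiff_const_smul (m : ℝ)).contMDiff.comp
      ((C.contMDiff_emb.comp (φ (τ m)).contMDiff).sub C.contMDiff_emb)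
  have hF : ∀ m, ContDiff ℝ ∞ (F m) := fun m =>
    contDiff_id.add ((C.contDiff_ext hβ (hh m)).const_smul _)
  have hstep : ∀ r y, SmoothConv atTop r (stepQuotient F) Y y := fun r y => by
    have h1 := C.smoothConv_ext (h := h) hβ
        (fun i x hx => C.smoothConv_push hI h0 hφ hφ0 hk hint hτ hτk
      (IsManifold.chart_mem_maximalAtlas (C.center i)) hx r) y
    refine h1.congr ?_ (EventuallyEq.refl _ _)
    filter_upwards [tendsto_fst.eventually (eventually_gt_atTop 0)] with q hq
    have : (q.1 : ℝ) ≠ 0 := by positivity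
    simp [stepQuotient, F, h, smul_smul, this]
  have hlim := fun r y => SmoothConv.iterate_euler hY hΦ hF (hstep r) y
  have hsemi : ∀ m > 0, ∀ p, (F m)^[m] (C.emb p) = C.emb ((φ (τ m) ^ m) p) := fun m hm p => by
    have hm' : (m : ℝ) ≠ 0 := by positivity
    rw [pow_apply]
    refine (Function.Semiconj.iterate_right (f := C.emb) (ga := φ (τ m)) (gb := F m)
      (fun q => ?_) m p).symm
    simp only [F, C.ext_emb (hβ1 q), h, inv_smul_smul₀ hm', add_sub_cancel]
  have hlim0 : ∀ p, Tendsto (fun q : ℕ × M => (φ (τ q.1) ^ q.1) q.2) (atTop ×ˢ 𝓝 p)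
      (𝓝 (exp X p)) := fun p => by
    rw [C.isClosedEmbedding_emb.isInducing.tendsto_nhds_iff, hexp]
    have h1 := (hlim 0 (C.emb p)).tendsto.comp (tendsto_fst.prodMk
      ((C.contMDiff_emb.continuous.tendsto p).comp (tendsto_snd (f := (atTop : Filter ℕ)))))
    refine h1.congr' ?_
    filter_upwards [tendsto_fst.eventually (eventually_gt_atTop 0)] with q hq
    exact hsemi _ hq _
  refine ⟨fun m => φ (τ m) ^ m, ?_, hlim0, ?_⟩
  · filter_upwards [(hτ.mono_right nhdsWithin_le_nhds).eventually (hI.mem_nhds h0)] with m hm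
    exact G.pow_mem (hφG _ hm) m
  · intro χ hχ ψ hψ p hp hpψ r
    have hle : (r : WithTop ℕ∞) ≤ ∞ := by exact_mod_cast le_top
    obtain ⟨g, hg, hge⟩ := C.exists_chart_extension hψ hpψ
    have h1 : SmoothConv atTop r (fun m y => (F m)^[m] (C.emb (χ.symm y)))
        (fun y => Φ 1 (C.emb (χ.symm y))) (χ p) :=
      SmoothConv.comp_right (hlim r _) ((contDiffAt_comp_symm hχ (χ.map_source hp)
        (C.contMDiff_emb _)).of_le hle)
    have h2 := SmoothConv.comp_left (g := g) (by
      rw [← hexp, χ.left_inv hp]; exact hg.of_le hle) h1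
    refine h2.congr ?_ ?_
    · filter_upwards [tendsto_fst.eventually (eventually_gt_atTop 0),
        ((hlim0 p).comp (tendsto_prod_symm atTop hp)).eventually hge] with q hq hq'
      rw [hsemi _ hq]
      exact hq'
    · have h3 := (χ.continuousAt_symm (χ.map_source hp)).tendsto
      rw [χ.left_inv hp] at h3
      filter_upwards [(((exp X).contMDiff.continuous.tendsto p).comp h3).eventually hge] with y hy
      rw [← hexp]
      exact hy

end DiffTangent

/-- On a compact manifold, `exp : 𝔛(M) → Diff(M)` is everywhere the time-one map of the flow, and
the group generated by `exp (T₀G)` lies in the closure of `G` in the `C^∞` topology. -/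
theorem mainTheorem2 {n : ℕ} {M : Type*} [TopologicalSpace M] [T2Space M] [CompactSpace M]
    [ChartedSpace (EuclideanSpace ℝ (Fin n)) M] [IsManifold (𝓡 n) ∞ M]
    (G : Subgroup (DiffTangent.Diff n M)) :
    (∀ X : DiffTangent.VectorFields n M, DiffTangent.IsTimeOneMap X (DiffTangent.exp X)) ∧
    (Subgroup.closure (DiffTangent.exp '' DiffTangent.tangentAlgebra G) :
        Set (DiffTangent.Diff n M)) ⊆
      closure[DiffTangent.smoothTopology n M] (G : Set (DiffTangent.Diff n M)) := by
  refine ⟨DiffTangent.isTimeOneMap_exp, Subset.trans ?_ (DiffTangent.seqClosure_subset_closure G)⟩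
  refine (Subgroup.closure_le _).2 ?_
  rintro _ ⟨X, hX, rfl⟩
  exact DiffTangent.exp_mem_seqClosure hX
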